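/- **Setting.** Fix $\alpha>0$, $\delta>0$. For each $n\ge 1$ let $p=p_n\in(0,1)$ and $\beta=\beta_n>0$. In the two-group model the triples $(\nu_i,\theta_i,Y_i)$, $i=1,\dots,n$, are i.i.d. with $P(\nu_i=1)=p$, $P(\nu_i=0)=1-p$; $\theta_i\mid\nu_i=0\sim Ga(\alpha,\beta)$, $\theta_i\mid\nu_i=1\sim Ga(\alpha,\beta+\delta)$ (shape, scale); and $Y_i\mid\theta_i\sim Poi(\theta_i)$. We test $H_{0i}:\nu_i=0$ against $H_{1i}:\nu_i=1$ simultaneously for $i=1,\dots,n$, on the basis of $(Y_1,\dots,Y_n)$. The Bayes risk (additive $0$-$1$ loss) of a multiple testing rule is $R=\sum_{i=1}^n[(1-p)t_{1i}+p\,t_{2i}]$, where $t_{1i}=P(H_{0i}\text{ is rejected}\mid\nu_i=0)$ and $t_{2i}=P(H_{0i}\text{ is accepted}\mid\nu_i=1)$. Let $R^{\rm BO}_{\rm Opt}$ be the Bayes risk of the Bayes Oracle, which rejects $H_{0i}$ iff $$Y_i>\frac{\log\frac{1-p}{p}+\alpha\log\frac{\beta+\delta+1}{\beta+1}}{\log\frac{(\beta+\delta)(\beta+1)}{\beta(\beta+\delta+1)}}.$$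 **One-group prior.** Let $a>1$, $K>0$, and let $L:(0,\infty)\to(0,\infty)$ be measurable and slowly varying at infinity, such that $\pi_1(x)=Kx^{-a-1}L(x)$ is a probability density on $(0,\infty)$. Assume that there are $c_0,t_0>0$ with $L(t)\ge c_0$ for all $t\ge t_0$, that $\lim_{t\to\infty}L(t)$ exists in $(0,\infty)$, and that $\sup_{t>0}L(t)<\infty$. For $\tau>0$ let $E(\kappa\mid y,\tau)$ be the posterior mean of $\kappa=1/(1+\lambda^2\tau^2)$ given $Y=y$ in the model $\lambda^2\sim\pi_1$, $\theta\mid\lambda^2\sim Ga(\alpha,\lambda^2\tau^2)$, $Y\mid\theta\sim Poi(\theta)$. **Empirical Bayes rule.** Put $\hat\tau=\max\{\frac1n,\frac1n\#\{i\le n:Y_i\ge1\}\}$. The rule rejects $H_{0i}$ iff $1-E(\kappa\mid Y_i,\hat\tau)>\frac{\delta}{2(\delta+1)}$, where $E(\kappa\mid Y_i,\hat\tau)$ is $E(\kappa\mid Y_i,\tau)$ evaluated at $\tau=\hat\tau$. Let $R^{\rm EB}_{\rm OG}$ be its Bayes risk in the two-group model. **Theorem.** Write $f_n\propto g_n$ if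 $f_n/g_n$ converges to a constant in $(0,\infty)$ as $n\to\infty$ (for instance, if $f_n=cg_n$ with a constant $c>0$). Suppose that $p_n\propto n^{-\epsilon}$ for some $\epsilon\in(0,1)$ and $\beta_n\propto p_n^{C_1}$ for some $C_1>1$. Then $$1\le\liminf_{n\to\infty}\frac{R^{\rm EB}_{\rm OG}}{R^{\rm BO}_{\rm Opt}}\le\limsup_{n\to\infty}\frac{R^{\rm EB}_{\rm OG}}{R^{\rm BO}_{\rm Opt}}\le(\delta+1)^\alpha\,P\Big(Y\le 2a+\alpha-\frac{2(a+\alpha)}{\delta+2}\Big),$$ where $Y\sim NB(\alpha,\frac1{\delta+1})$, i.e. $P(Y=y)=\frac{\Gamma(y+\alpha)}{\Gamma(\alpha)\,y!}\big(1-\frac1{\delta+1}\big)^y\big(\frac1{\delta+1}\big)^\alpha$ for $y=0,1,2,\dots$ -/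

import Mathlib

open MeasureTheory ProbabilityTheory Filter Topology Set
open scoped ENNReal NNReal

namespace SparseCount

noncomputable section

/-! ### Gamma and Poisson transition kernels -/

/-- The Poisson distribution as a Markov kernel in its mean. -/
def poissonKernel : Kernel ℝ ℕ where
  toFun θ := poissonMeasure θ.toNNReal
  measurable' := by
    refine Measure.measurable_of_measurable_coe _ fun s hs => ?_
    simp only [poissonMeasure]
    simp_rw [Measure.sum_apply _ hs, Measure.smul_apply]
    refine Measurable.tsum fun k => ?_
    simp only [smul_eq_mul]
    refine Measurable.mul_const ?_ _
    fun_prop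

instance : IsMarkovKernel poissonKernel :=
  ⟨fun θ => by change IsProbabilityMeasure (poissonMeasure θ.toNNReal); infer_instance⟩

/-- The Gamma distribution with shape `α` and *scale* `s` (density proportional to
`x ^ (α - 1) * exp (-x / s)` on `(0, ∞)`), as a Markov kernel in `s`. Outside the parameter range
`0 < α`, `0 < s` it is set to the unit mass at `0`. -/
def gammaKernel (α : ℝ) : Kernel ℝ ℝ where
  toFun s := open Classical in if 0 < α ∧ 0 < s then gammaMeasure α s⁻¹ else Measure.dirac 0
  measurable' := by
    classical
    refine Measurable.ite (measurableSet_setOfPred.2 (by fun_prop)) ?_ measurable_const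
    refine Measure.measurable_of_measurable_coe _ fun t ht => ?_
    simp only [gammaMeasure, withDensity_apply _ ht]
    refine Measurable.lintegral_prod_right' (f := fun q : ℝ × ℝ => gammaPDF α q.1⁻¹ q.2) ?_
    simp only [gammaPDF_eq]
    refine ENNReal.measurable_ofReal.comp (Measurable.ite ?_ ?_ measurable_const)
    · exact measurableSet_le measurable_const measurable_snd
    · fun_prop

instance (α : ℝ) : IsMarkovKernel (gammaKernel α) :=
  ⟨fun s => by
    classical
    change IsProbabilityMeasure
      (if 0 < α ∧ 0 < s then gammaMeasure α s⁻¹ else Measure.dirac 0)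
    split_ifs with h
    · exact isProbabilityMeasure_gammaMeasure h.1 (inv_pos.2 h.2)
    · infer_instance⟩

/-! ### The negative binomial distribution -/

/-- Negative binomial probability mass function with (real) size `α` and success probability `q`:
`binom (y + α - 1) y * (1 - q) ^ y * q ^ α`, where the generalised binomial coefficient
`binom (y + α - 1) y` is `Γ(y + α) / (Γ(α) y!)`. -/
def negBinomialPMF (α q : ℝ) (y : ℕ) : ℝ :=
  Real.Gamma (y + α) / (Real.Gamma α * (y.factorial : ℝ)) * (1 - q) ^ y * q ^ α

/-- The negative binomial law `NB(α, q)` on `ℕ`. -/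
def negBinomial (α q : ℝ) : Measure ℕ :=
  Measure.sum fun y => ENNReal.ofReal (negBinomialPMF α q y) • Measure.dirac y

/-! ### The two-group model -/

/-- Law of `ν`, with `P(ν = true) = p` and `P(ν = false) = 1 - p`. -/
def indicatorLaw (p : ℝ) : Measure Bool :=
  ENNReal.ofReal (1 - p) • Measure.dirac false + ENNReal.ofReal p • Measure.dirac true

instance (p : ℝ) : IsFiniteMeasure (indicatorLaw p) := by
  refine ⟨?_⟩
  simp [indicatorLaw]

/-- Joint law of `((ν, θ), Y)` for one coordinate of the two-group model: `ν` is Bernoulli,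
`θ ∼ Ga(α, β)` if `ν = false` and `θ ∼ Ga(α, β + δ)` if `ν = true`, and `Y ∼ Poi(θ)`. -/
def twoGroupLaw (p α β δ : ℝ) : Measure ((Bool × ℝ) × ℕ) :=
  (indicatorLaw p ⊗ₘ
      (gammaKernel α).comap (fun ν : Bool => if ν then β + δ else β) (measurable_of_finite _)) ⊗ₘ
    poissonKernel.comap (fun x : Bool × ℝ => x.2) measurable_snd

instance (p α β δ : ℝ) : IsFiniteMeasure (twoGroupLaw p α β δ) := by
  unfold twoGroupLaw; infer_instance

/-- `n` independent coordinates of the two-group model. -/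
def twoGroupModel (n : ℕ) (p α β δ : ℝ) : Measure (Fin n → (Bool × ℝ) × ℕ) :=
  Measure.pi fun _ => twoGroupLaw p α β δ

/-- The latent indicator `ν i`; `H_{0i}` is `ν i = false` and `H_{1i}` is `ν i = true`. -/
def latent {n : ℕ} (ω : Fin n → (Bool × ℝ) × ℕ) (i : Fin n) : Bool := (ω i).1.1

/-- The vector of observed counts `Y`. -/
def counts {n : ℕ} (ω : Fin n → (Bool × ℝ) × ℕ) (i : Fin n) : ℕ := (ω i).2

/-! ### Multiple testing rules and their Bayes risk

A multiple testing rule assigns to the data the set of indices `i` for which `H_{0i}` is rejected. -/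

/-- Probability under `H_{0i}` that `H_{0i}` is rejected. -/
def typeIError (n : ℕ) (p α β δ : ℝ) (reject : (Fin n → ℕ) → Set (Fin n)) (i : Fin n) : ℝ :=
  (ProbabilityTheory.cond (twoGroupModel n p α β δ) {ω | latent ω i = false}).real {ω | i ∈ reject (counts ω)}

/-- Probability under `H_{1i}` that `H_{0i}` is accepted. -/
def typeIIError (n : ℕ) (p α β δ : ℝ) (reject : (Fin n → ℕ) → Set (Fin n)) (i : Fin n) : ℝ :=
  (ProbabilityTheory.cond (twoGroupModel n p α β δ) {ω | latent ω i = true}).real {ω | i ∉ reject (counts ω)}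

/-- Bayes risk of a multiple testing rule for the additive `0-1` loss. -/
def bayesRisk (n : ℕ) (p α β δ : ℝ) (reject : (Fin n → ℕ) → Set (Fin n)) : ℝ :=
  ∑ i, ((1 - p) * typeIError n p α β δ reject i + p * typeIIError n p α β δ reject i)

/-! ### The Bayes Oracle -/

/-- The threshold of the Bayes Oracle. -/
def oracleThreshold (p α β δ : ℝ) : ℝ :=
  (Real.log ((1 - p) / p) + α * Real.log ((β + δ + 1) / (β + 1))) /
    Real.log (((β + δ) * (β + 1)) / (β * (β + δ + 1)))

/-- The Bayes Oracle rejects `H_{0i}` iff `Y i` exceeds the threshold. -/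
def oracleRule (n : ℕ) (p α β δ : ℝ) (Y : Fin n → ℕ) : Set (Fin n) :=
  {i | oracleThreshold p α β δ < (Y i : ℝ)}

/-! ### One-group global-local priors -/

/-- Density `K * x ^ (-a - 1) * L x` of the squared local parameter `λ²`, for `x > 0`. -/
def localDensity (K a : ℝ) (L : ℝ → ℝ) (x : ℝ) : ℝ := K * x ^ (-a - 1) * L x

/-- The prior law of `λ²` on `(0, ∞)`. -/
def localPrior (K a : ℝ) (L : ℝ → ℝ) : Measure ℝ :=
  (volume.restrict (Ioi 0)).withDensity fun x => ENNReal.ofReal (localDensity K a L x)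

/-- Slow variation at infinity in Karamata's sense. -/
def SlowlyVarying (L : ℝ → ℝ) : Prop :=
  ∀ c : ℝ, 0 < c → Tendsto (fun x => L (c * x) / L x) atTop (𝓝 1)

/-- Joint law of `((λ², θ), Y)` for one coordinate of the one-group model with global parameter
`τ`: `λ²` has the prior above, `θ ∼ Ga(α, λ² τ²)` given `λ²`, and `Y ∼ Poi(θ)` given `θ`. -/
def oneGroupLaw (K a : ℝ) (L : ℝ → ℝ) (α τ : ℝ) : Measure ((ℝ × ℝ) × ℕ) :=
  (localPrior K a L ⊗ₘ
      (gammaKernel α).comap (fun x : ℝ => x * τ ^ 2) (measurable_id.mul_const _)) ⊗ₘ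
    poissonKernel.comap (fun x : ℝ × ℝ => x.2) measurable_snd

/-- The shrinkage coefficient `κ = 1 / (1 + λ² τ²)`, as a function of `λ²`. -/
def shrinkage (τ x : ℝ) : ℝ := 1 / (1 + x * τ ^ 2)

/-- The posterior mean `E(κ | Y = y, τ)` in the one-group model. -/
def posteriorMean (K a : ℝ) (L : ℝ → ℝ) (α τ : ℝ) (y : ℕ) : ℝ :=
  ∫ ω, shrinkage τ ω.1.1 ∂(ProbabilityTheory.cond (oneGroupLaw K a L α τ) {ω | ω.2 = y})

/-- `τ̂ = max {1/n, (1/n) #{i : Y i ≥ 1}}`. -/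
def tauHat (n : ℕ) (Y : Fin n → ℕ) : ℝ :=
  max (1 / (n : ℝ)) (1 / (n : ℝ) * ((Finset.univ.filter fun i => 1 ≤ Y i).card : ℝ))

/-- The empirical Bayes rule: reject `H_{0i}` iff `1 - E(κ | Y i, τ̂) > δ / (2 (δ + 1))`. -/
def ebRule (n : ℕ) (K a : ℝ) (L : ℝ → ℝ) (α δ : ℝ) (Y : Fin n → ℕ) : Set (Fin n) :=
  {i | δ / (2 * (δ + 1)) < 1 - posteriorMean K a L α (tauHat n Y) (Y i)}

/-- `f ∝ g` as `n → ∞`: the ratio `f n / g n` tends to a positive constant (in particular this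
holds if `f n = c * g n` for a constant `c > 0` and `g n ≠ 0` for large `n`). -/
def AsympProportional (f g : ℕ → ℝ) : Prop :=
  ∃ c : ℝ, 0 < c ∧ Tendsto (fun n => f n / g n) atTop (𝓝 c)

end

end SparseCount

/-!
After division by `n`, both risks are of the exact order `p`, and the only contribution of that
order comes from accepting signals.

*Marginals.* A Gamma mixture of Poisson laws is negative binomial
(`lintegral_poissonKernel_singleton`), so `Y` has law `NB(α, 1 / (1 + β))` under the null and
`NB(α, 1 / (1 + β + δ))` under the alternative. Under the null `P(1 ≤ Y) ≤ α β = o(p)`: nonzero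
counts are essentially always signals. The Oracle threshold lies in `[0, 1)` for large `n`
(`oracleThreshold_lt_natCast_iff`), so the Oracle rejects exactly the nonzero counts, and its risk
is `n p ((1 + δ) ^ (-α) + o(1))`.

*The one-group rule for small `τ`.* Integrating out `θ`, the posterior mean of `1 - κ` is a quotient
of two integrals against the prior of `λ²` (`one_sub_posteriorMean`). At `y = 0` it tends to `0` as
`τ → 0`. For `y > a` the substitution `u = λ² τ²` and dominated convergence turn the quotient into
one of Beta integrals, with value `(y - a) / (y + α)`; this exceeds `δ / (2 (δ + 1))` exactly when
`y > 2 a + α - 2 (a + α) / (δ + 2)`. Hence for each `N` there is `τ₀ > 0` such that for all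
`τ ≤ τ₀` the rule accepts at the count `0` and rejects at all counts up to `N` above that level
(`exists_decision_threshold`).

*The estimate of `τ`.* The proportion of nonzero counts has mean at most `α β + p`, and a second
moment bound gives `P(τ̂ > τ₀) = O(p / n + p²) = o(p)` (`twoGroupModel_real_tauHat_gt_le`). Since
each risk is a sum of joint probabilities of the latent indicator and the decision
(`bayesRisk_eq`), the event `τ̂ > τ₀` can be discarded by a union bound, without conditioning on
the dependence between `Y i` and `τ̂`.

Together these bound the empirical Bayes risk below by `n p ((1 + δ) ^ (-α) - o(1))` and above by
`n p` times the limiting probability that the count of a signal does not lie among the rejected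
counts up to `N`. The upper bound of the theorem follows on letting `N → ∞` last.
-/

namespace SparseCount

/-! ### Gamma-Poisson mixtures and the law of one coordinate -/

lemma gammaKernel_apply {α s : ℝ} (hα : 0 < α) (hs : 0 < s) :
    gammaKernel α s = gammaMeasure α s⁻¹ :=
  if_pos ⟨hα, hs⟩

lemma poissonKernel_singleton {θ : ℝ} (hθ : 0 ≤ θ) (y : ℕ) :
    poissonKernel θ {y} = ENNReal.ofReal (Real.exp (-θ) * θ ^ y / y.factorial) := by
  change poissonMeasure θ.toNNReal {y} = _
  rw [poissonMeasure_singleton, Real.coe_toNNReal θ hθ]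

lemma negBinomial_singleton (α q : ℝ) (y : ℕ) :
    negBinomial α q {y} = ENNReal.ofReal (negBinomialPMF α q y) := by
  rw [negBinomial, Measure.sum_smul_dirac_singleton]

lemma negBinomialPMF_nonneg {α q : ℝ} (hα : 0 < α) (hq : 0 ≤ q) (hq1 : q ≤ 1) (y : ℕ) :
    0 ≤ negBinomialPMF α q y := by
  have : 0 < Real.Gamma (y + α) := Real.Gamma_pos_of_pos (by positivity)
  have : 0 < Real.Gamma α := Real.Gamma_pos_of_pos hα
  have : 0 ≤ 1 - q := by linarith
  unfold negBinomialPMF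
  positivity

/-- Mixing Poisson laws over a Gamma distributed mean gives negative binomial probabilities. -/
lemma lintegral_poissonKernel_singleton {α s : ℝ} (hα : 0 < α) (hs : 0 < s) (y : ℕ) :
    ∫⁻ θ, poissonKernel θ {y} ∂(gammaKernel α s) =
      ENNReal.ofReal (negBinomialPMF α (1 / (1 + s)) y) := by
  have hG : 0 < Real.Gamma α := Real.Gamma_pos_of_pos hα
  have hm : Measurable (gammaPDF α s⁻¹) := (measurable_gammaPDFReal α s⁻¹).ennreal_ofReal
  rw [gammaKernel_apply hα hs, gammaMeasure,
    lintegral_withDensity_eq_lintegral_mul _ hm (poissonKernel.measurable_coe (.of_discrete))]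
  have h0 : ∫⁻ θ, (gammaPDF α s⁻¹ * fun θ => poissonKernel θ {y}) θ =
      ∫⁻ θ in Ioi 0, ENNReal.ofReal (((s⁻¹) ^ α / (Real.Gamma α * y.factorial)) *
        (θ ^ ((y + α) - 1) * Real.exp (-((1 + s⁻¹) * θ)))) := by
    rw [← lintegral_indicator measurableSet_Ioi]
    refine lintegral_congr_ae ?_
    filter_upwards [Measure.ae_ne volume (0 : ℝ)] with θ hθ
    rcases lt_or_gt_of_ne hθ with h | h
    · rw [indicator_of_notMem (by simpa using h.le), Pi.mul_apply, gammaPDF_of_neg h, zero_mul]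
    · rw [indicator_of_mem (by simpa using h), Pi.mul_apply, gammaPDF_of_nonneg h.le,
        poissonKernel_singleton h.le, ← ENNReal.ofReal_mul (by positivity)]
      congr 1
      have e1 : θ ^ ((y : ℝ) + α - 1) = θ ^ y * θ ^ (α - 1) := by
        rw [add_sub_assoc, Real.rpow_add h, Real.rpow_natCast]
      have e2 : Real.exp (-((1 + s⁻¹) * θ)) = Real.exp (-(s⁻¹ * θ)) * Real.exp (-θ) := by
        rw [← Real.exp_add]; congr 1; ring
      rw [e1, e2]
      field_simp
  have hy : 0 < (y : ℝ) + α := by positivity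
  have hGy : 0 < Real.Gamma (y + α) := Real.Gamma_pos_of_pos hy
  have hr : 0 < 1 + s⁻¹ := by positivity
  have hval := Real.integral_rpow_mul_exp_neg_mul_Ioi hy hr
  have hint : IntegrableOn (fun θ : ℝ => θ ^ ((y + α) - 1) * Real.exp (-((1 + s⁻¹) * θ)))
      (Ioi 0) := by
    -- a nonzero Bochner integral can only come from an integrable function
    refine Integrable.of_integral_ne_zero ?_
    rw [hval]
    positivity
  rw [h0, ← ofReal_integral_eq_lintegral_ofReal (hint.const_mul _) ?_, integral_const_mul, hval]
  · congr 1
    unfold negBinomialPMF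
    have e1 : 1 / (1 + s⁻¹) = s / (1 + s) := by field_simp; ring
    have e2 : 1 - 1 / (1 + s) = s / (1 + s) := by field_simp; ring
    have e3 : s⁻¹ ^ α * (s / (1 + s)) ^ α = (1 / (1 + s)) ^ α := by
      rw [← Real.mul_rpow (by positivity) (by positivity)]
      congr 1; field_simp
    rw [e1, e2, Real.rpow_add (by positivity), Real.rpow_natCast, ← e3]
    field_simp
  · filter_upwards [ae_restrict_mem measurableSet_Ioi] with θ hθ
    have : 0 < θ := hθ
    positivity

lemma bind_gammaKernel_poissonKernel {α s : ℝ} (hα : 0 < α) (hs : 0 < s) :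
    (gammaKernel α s).bind poissonKernel = negBinomial α (1 / (1 + s)) := by
  refine Measure.ext_of_singleton fun y => ?_
  rw [Measure.bind_apply (measurableSet_singleton y) poissonKernel.measurable.aemeasurable,
    lintegral_poissonKernel_singleton hα hs, negBinomial_singleton]

lemma lintegral_poissonKernel {α s : ℝ} (hα : 0 < α) (hs : 0 < s) (A : Set ℕ) :
    ∫⁻ θ, poissonKernel θ A ∂(gammaKernel α s) = negBinomial α (1 / (1 + s)) A := by
  rw [← bind_gammaKernel_poissonKernel hα hs,
    Measure.bind_apply (.of_discrete) poissonKernel.measurable.aemeasurable]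

lemma isProbabilityMeasure_negBinomial {α s : ℝ} (hα : 0 < α) (hs : 0 < s) :
    IsProbabilityMeasure (negBinomial α (1 / (1 + s))) := by
  constructor
  rw [← lintegral_poissonKernel hα hs]
  simp

/-- The scale parameter of the Gamma law of `θ` given the indicator `ν`. -/
def groupScale (β δ : ℝ) (b : Bool) : ℝ := if b then β + δ else β

/-- The prior probability of the group `ν = b`. -/
def groupWeight (p : ℝ) (b : Bool) : ℝ := if b then p else 1 - p

/-- In the group `ν = b` the count has a negative binomial law. -/
lemma twoGroupLaw_apply {p α β δ : ℝ} (hα : 0 < α) (hβ : 0 < β)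
    (hδ : 0 < δ) (b : Bool) (A : Set ℕ) :
    twoGroupLaw p α β δ {x | x.1.1 = b ∧ x.2 ∈ A} =
      ENNReal.ofReal (groupWeight p b) * negBinomial α (1 / (1 + groupScale β δ b)) A := by
  have hmb : MeasurableSet {x : Bool × ℝ | x.1 = b} := measurable_fst (measurableSet_singleton b)
  have hm : MeasurableSet {x : (Bool × ℝ) × ℕ | x.1.1 = b ∧ x.2 ∈ A} :=
    (measurable_fst hmb).inter (measurable_snd (.of_discrete))
  unfold twoGroupLaw
  rw [Measure.compProd_apply hm]
  have h1 : ∀ x : Bool × ℝ,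
      (poissonKernel.comap (fun x : Bool × ℝ => x.2)
        (measurable_snd : Measurable fun x : Bool × ℝ => x.2)) x
        (Prod.mk x ⁻¹' {x | x.1.1 = b ∧ x.2 ∈ A}) =
      {x : Bool × ℝ | x.1 = b}.indicator (fun x => poissonKernel x.2 A) x := by
    intro x
    by_cases hx : x.1 = b
    · simp [hx, Kernel.comap_apply]
    · simp [hx]
  have hmA : Measurable fun θ => poissonKernel θ A := poissonKernel.measurable_coe (.of_discrete)
  simp_rw [h1]
  have hmi : Measurable ({x : Bool × ℝ | x.1 = b}.indicator fun x => poissonKernel x.2 A) :=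
    (hmA.comp measurable_snd).indicator hmb
  rw [Measure.lintegral_compProd hmi]
  have h2 : ∀ c : Bool, (∫⁻ θ, {x : Bool × ℝ | x.1 = b}.indicator (fun x => poissonKernel x.2 A)
      (c, θ) ∂((gammaKernel α).comap (fun ν : Bool => if ν then β + δ else β)
        (measurable_of_finite _) c)) =
      if c = b then negBinomial α (1 / (1 + groupScale β δ b)) A else 0 := by
    intro c
    split_ifs with hc
    · subst hc
      rw [← lintegral_poissonKernel hα (by cases c <;> simp [groupScale] <;> positivity)]
      simp [Kernel.comap_apply, groupScale]
    · simp [hc]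
  simp_rw [h2]
  simp only [indicatorLaw, lintegral_add_measure, lintegral_smul_measure, lintegral_dirac]
  cases b <;> simp [groupWeight]

lemma isProbabilityMeasure_twoGroupLaw {p α β δ : ℝ} (hp : 0 < p) (hp1 : p < 1) :
    IsProbabilityMeasure (twoGroupLaw p α β δ) := by
  have : IsProbabilityMeasure (indicatorLaw p) := by
    constructor
    simp only [indicatorLaw, Measure.add_apply, Measure.smul_apply, measure_univ, smul_eq_mul,
      mul_one]
    rw [← ENNReal.ofReal_add (by linarith) hp.le]
    simp
  unfold twoGroupLaw
  infer_instance

/-! ### The posterior mean as a quotient of integrals -/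

/-- The function `u ↦ (u / (1 + u)) ^ m * (1 + u) ^ (-α)`. With `u = λ² τ²` and `m = y` it is, up to
a factor independent of `u`, the probability of `Y = y` given `λ²`; raising `m` by one multiplies
by `1 - κ`. -/
noncomputable def countWeight (α : ℝ) (m : ℕ) (u : ℝ) : ℝ := (u / (1 + u)) ^ m * (1 + u) ^ (-α)

lemma countWeight_pos {α u : ℝ} (m : ℕ) (hu : 0 < u) : 0 < countWeight α m u := by
  unfold countWeight; positivity

lemma countWeight_le_one {α u : ℝ} (hα : 0 < α) (m : ℕ) (hu : 0 ≤ u) : countWeight α m u ≤ 1 := by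
  unfold countWeight
  have h1 : (u / (1 + u)) ^ m ≤ 1 :=
    pow_le_one₀ (by positivity) ((div_le_one (by linarith)).2 (by linarith))
  have h2 : (1 + u) ^ (-α) ≤ 1 :=
    Real.rpow_le_one_of_one_le_of_nonpos (by linarith) (by linarith)
  exact mul_le_one₀ h1 (by positivity) h2

lemma countWeight_succ {α u : ℝ} (m : ℕ) :
    countWeight α (m + 1) u = u / (1 + u) * countWeight α m u := by
  unfold countWeight; ring

lemma measurable_countWeight (α : ℝ) (m : ℕ) : Measurable (countWeight α m) := by
  unfold countWeight; fun_prop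

lemma negBinomialPMF_eq_countWeight {α u : ℝ} (y : ℕ) (hu : 0 ≤ u) :
    negBinomialPMF α (1 / (1 + u)) y =
      Real.Gamma (y + α) / (Real.Gamma α * (y.factorial : ℝ)) * countWeight α y u := by
  unfold negBinomialPMF countWeight
  have e : 1 - 1 / (1 + u) = u / (1 + u) := by
    have : 1 + u ≠ 0 := by positivity
    field_simp; ring
  rw [e, one_div, Real.inv_rpow (by positivity), ← Real.rpow_neg (by positivity)]
  ring

section OneGroup

variable {K a α τ : ℝ} {L : ℝ → ℝ}

lemma measurable_localDensity (hL : Measurable L) : Measurable (localDensity K a L) := by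
  unfold localDensity; fun_prop

lemma localDensity_pos (hK : 0 < K) (hLpos : ∀ x, 0 < x → 0 < L x) {x : ℝ} (hx : 0 < x) :
    0 < localDensity K a L x := by
  have := hLpos x hx
  unfold localDensity; positivity

instance : SFinite (localPrior K a L) := by
  unfold localPrior; infer_instance

/-- Joint integrals over `{Y = y}` of functions of `λ²`, with `θ` integrated out. -/
lemma setLIntegral_oneGroupLaw (hL : Measurable L) (hα : 0 < α) (hτ : 0 < τ) (y : ℕ)
    {g : ℝ → ℝ≥0∞} (hg : Measurable g) :
    ∫⁻ ω in {ω | ω.2 = y}, g ω.1.1 ∂(oneGroupLaw K a L α τ) =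
      ∫⁻ x in Ioi 0, ENNReal.ofReal (localDensity K a L x) *
        (g x * ENNReal.ofReal (negBinomialPMF α (1 / (1 + x * τ ^ 2)) y)) := by
  have hmy : MeasurableSet {ω : (ℝ × ℝ) × ℕ | ω.2 = y} :=
    measurable_snd (measurableSet_singleton y)
  have hmP : Measurable fun θ => poissonKernel θ {y} :=
    poissonKernel.measurable_coe (measurableSet_singleton y)
  have hg2 : Measurable fun ω : (ℝ × ℝ) × ℕ => g ω.1.1 := by fun_prop
  rw [← lintegral_indicator hmy, oneGroupLaw, Measure.lintegral_compProd (hg2.indicator hmy)]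
  have h1 : ∀ x : ℝ × ℝ, ∫⁻ k, {ω : (ℝ × ℝ) × ℕ | ω.2 = y}.indicator (fun ω => g ω.1.1) (x, k)
      ∂((poissonKernel.comap (fun x : ℝ × ℝ => x.2)
        (measurable_snd : Measurable fun x : ℝ × ℝ => x.2)) x) =
      g x.1 * poissonKernel x.2 {y} := by
    intro x
    rw [Kernel.comap_apply, ← lintegral_indicator_const (measurableSet_singleton y)]
    rfl
  simp_rw [h1]
  have hmm : Measurable fun x : ℝ × ℝ => g x.1 * poissonKernel x.2 {y} :=
    (hg.comp measurable_fst).mul (hmP.comp measurable_snd)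
  rw [Measure.lintegral_compProd hmm]
  have hmI : Measurable fun x : ℝ => ∫⁻ θ, g x * poissonKernel θ {y}
      ∂((gammaKernel α).comap (fun x : ℝ => x * τ ^ 2) (measurable_id.mul_const _) x) :=
    Measurable.lintegral_kernel_prod_right' hmm
  rw [localPrior, lintegral_withDensity_eq_lintegral_mul _
    (measurable_localDensity hL).ennreal_ofReal hmI]
  refine setLIntegral_congr_fun measurableSet_Ioi fun x hx => ?_
  have hx : 0 < x := hx
  rw [Pi.mul_apply, lintegral_const_mul _ hmP, Kernel.comap_apply,
    lintegral_poissonKernel_singleton hα (by positivity)]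

lemma integrableOn_localDensity (hL : Measurable L) (hK : 0 < K) (hLpos : ∀ x, 0 < x → 0 < L x)
    (hdens : ∫⁻ x in Ioi (0 : ℝ), ENNReal.ofReal (localDensity K a L x) = 1) :
    IntegrableOn (localDensity K a L) (Ioi 0) := by
  refine ⟨(measurable_localDensity hL).aestronglyMeasurable, ?_⟩
  rw [hasFiniteIntegral_iff_ofReal, hdens]
  · exact ENNReal.one_lt_top
  · filter_upwards [ae_restrict_mem measurableSet_Ioi] with x hx
    exact (localDensity_pos hK hLpos hx).le

lemma integral_localDensity (hL : Measurable L) (hK : 0 < K) (hLpos : ∀ x, 0 < x → 0 < L x)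
    (hdens : ∫⁻ x in Ioi (0 : ℝ), ENNReal.ofReal (localDensity K a L x) = 1) :
    ∫ x in Ioi 0, localDensity K a L x = 1 := by
  rw [integral_eq_lintegral_of_nonneg_ae _ (measurable_localDensity hL).aestronglyMeasurable, hdens,
    ENNReal.toReal_one]
  filter_upwards [ae_restrict_mem measurableSet_Ioi] with x hx
  exact (localDensity_pos hK hLpos hx).le

/-- The integral of `countWeight α m (λ² τ²)` against the prior of `λ²`. -/
noncomputable def priorWeight (K a : ℝ) (L : ℝ → ℝ) (α τ : ℝ) (m : ℕ) : ℝ :=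
  ∫ x in Ioi 0, localDensity K a L x * countWeight α m (x * τ ^ 2)

lemma integrableOn_priorWeight (hL : Measurable L) (hK : 0 < K) (hLpos : ∀ x, 0 < x → 0 < L x)
    (hdens : ∫⁻ x in Ioi (0 : ℝ), ENNReal.ofReal (localDensity K a L x) = 1)
    (hα : 0 < α) (m : ℕ) :
    IntegrableOn (fun x => localDensity K a L x * countWeight α m (x * τ ^ 2)) (Ioi 0) := by
  refine (integrableOn_localDensity hL hK hLpos hdens).mono'
    ((measurable_localDensity hL).mul
      ((measurable_countWeight α m).comp (by fun_prop))).aestronglyMeasurable ?_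
  filter_upwards [ae_restrict_mem measurableSet_Ioi] with x hx
  have hx : 0 < x := hx
  have h1 := localDensity_pos (a := a) hK hLpos hx
  have h2 := countWeight_le_one hα m (u := x * τ ^ 2) (by positivity)
  have h3 : 0 ≤ countWeight α m (x * τ ^ 2) := by unfold countWeight; positivity
  rw [Real.norm_of_nonneg (by positivity)]
  exact mul_le_of_le_one_right h1.le h2

lemma priorWeight_pos (hL : Measurable L) (hK : 0 < K) (hLpos : ∀ x, 0 < x → 0 < L x)
    (hdens : ∫⁻ x in Ioi (0 : ℝ), ENNReal.ofReal (localDensity K a L x) = 1)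
    (hα : 0 < α) (hτ : 0 < τ) (m : ℕ) : 0 < priorWeight K a L α τ m := by
  have hpos : ∀ x ∈ Ioi (0 : ℝ), 0 < localDensity K a L x * countWeight α m (x * τ ^ 2) :=
    fun x hx => mul_pos (localDensity_pos hK hLpos hx)
      (countWeight_pos m (mul_pos hx (by positivity)))
  rw [priorWeight, setIntegral_pos_iff_support_of_nonneg_ae
    ((ae_restrict_mem measurableSet_Ioi).mono fun x hx => (hpos x hx).le)
    (integrableOn_priorWeight hL hK hLpos hdens hα m)]
  have hsub : Ioi 0 ⊆ Function.support fun x =>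
      localDensity K a L x * countWeight α m (x * τ ^ 2) := fun x hx => (hpos x hx).ne'
  rw [inter_eq_right.2 hsub]
  simp

/-- The posterior mean of `1 - κ` is a quotient of two integrals against the prior. -/
lemma one_sub_posteriorMean (hL : Measurable L) (hK : 0 < K) (hLpos : ∀ x, 0 < x → 0 < L x)
    (hdens : ∫⁻ x in Ioi (0 : ℝ), ENNReal.ofReal (localDensity K a L x) = 1)
    (hα : 0 < α) (hτ : 0 < τ) (y : ℕ) :
    1 - posteriorMean K a L α τ y =
      priorWeight K a L α τ (y + 1) / priorWeight K a L α τ y := by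
  set c : ℝ := Real.Gamma (y + α) / (Real.Gamma α * (y.factorial : ℝ)) with hc
  have hcpos : 0 < c := by
    have : 0 < Real.Gamma (y + α) := Real.Gamma_pos_of_pos (by positivity)
    have : 0 < Real.Gamma α := Real.Gamma_pos_of_pos hα
    positivity
  set s : Set ((ℝ × ℝ) × ℕ) := {ω | ω.2 = y}
  -- restricted integrals of a nonnegative function of `λ²`, in terms of real integrals
  have key : ∀ g : ℝ → ℝ, Measurable g → (∀ x, 0 < x → 0 ≤ g x) →
      (∫⁻ ω in s, ENNReal.ofReal (g ω.1.1) ∂(oneGroupLaw K a L α τ)).toReal =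
      c * ∫ x in Ioi 0, localDensity K a L x * (g x * countWeight α y (x * τ ^ 2)) := by
    intro g hg hg0
    rw [setLIntegral_oneGroupLaw hL hα hτ y hg.ennreal_ofReal, ← integral_const_mul,
      integral_eq_lintegral_of_nonneg_ae]
    · congr 1
      refine setLIntegral_congr_fun measurableSet_Ioi fun x hx => ?_
      have hx : 0 < x := hx
      have h1 := localDensity_pos (a := a) hK hLpos hx
      have h2 := hg0 x hx
      rw [negBinomialPMF_eq_countWeight y (by positivity), ← ENNReal.ofReal_mul h2,
        ← ENNReal.ofReal_mul h1.le, ← hc]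
      congr 1; ring
    · filter_upwards [ae_restrict_mem measurableSet_Ioi] with x hx
      have hx : 0 < x := hx
      have h1 := localDensity_pos (a := a) hK hLpos hx
      have h2 := hg0 x hx
      have h3 := (countWeight_pos (α := α) y (u := x * τ ^ 2) (by positivity)).le
      positivity
    · exact (((measurable_localDensity hL).mul
        (hg.mul ((measurable_countWeight α y).comp (by fun_prop)))).const_mul c).aestronglyMeasurable
  have hden : (oneGroupLaw K a L α τ s).toReal = c * priorWeight K a L α τ y := by
    have := key (fun _ => 1) measurable_const (fun _ _ => zero_le_one)
    simpa [priorWeight] using this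
  have hκm : Measurable fun x : ℝ => shrinkage τ x := by unfold shrinkage; fun_prop
  have hnum := key (shrinkage τ) hκm (fun x hx => by unfold shrinkage; positivity)
  have hsplit : ∫ x in Ioi 0, localDensity K a L x * (shrinkage τ x * countWeight α y (x * τ ^ 2)) =
      priorWeight K a L α τ y - priorWeight K a L α τ (y + 1) := by
    rw [priorWeight, priorWeight, ← integral_sub
      (integrableOn_priorWeight hL hK hLpos hdens hα y)
      (integrableOn_priorWeight hL hK hLpos hdens hα (y + 1))]
    refine setIntegral_congr_fun measurableSet_Ioi fun x hx => ?_
    have hx : 0 < x := hx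
    have : 1 + x * τ ^ 2 ≠ 0 := by positivity
    simp only [countWeight_succ, shrinkage]
    field_simp
    ring
  -- the prior lives on `(0, ∞)`, where the shrinkage coefficient is nonnegative
  have hae : ∀ᵐ ω ∂((oneGroupLaw K a L α τ).restrict s), 0 ≤ shrinkage τ ω.1.1 := by
    have hneg : MeasurableSet {x : ℝ | shrinkage τ x < 0} := measurableSet_lt hκm measurable_const
    have h0 := setLIntegral_oneGroupLaw (K := K) (a := a) hL hα hτ y
      (g := {x : ℝ | shrinkage τ x < 0}.indicator fun _ => 1) (measurable_const.indicator hneg)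
    rw [setLIntegral_congr_fun (g := fun _ => 0) measurableSet_Ioi ?_, lintegral_zero,
      lintegral_eq_zero_iff] at h0
    · filter_upwards [h0] with ω hω
      by_contra! hlt
      simp [hlt] at hω
    · exact (measurable_const.indicator hneg).comp (measurable_fst.comp measurable_fst)
    · intro x hx
      have hx : 0 < x := hx
      have : 0 ≤ shrinkage τ x := by unfold shrinkage; positivity
      simp [this]
  have hpm : posteriorMean K a L α τ y =
      (c * (priorWeight K a L α τ y - priorWeight K a L α τ (y + 1))) /
        (c * priorWeight K a L α τ y) := by
    rw [posteriorMean, ProbabilityTheory.cond, integral_smul_measure, ENNReal.toReal_inv, hden,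
      integral_eq_lintegral_of_nonneg_ae hae
        (hκm.comp (measurable_fst.comp measurable_fst)).aestronglyMeasurable, hnum, hsplit,
      smul_eq_mul, div_eq_inv_mul]
  have hD := priorWeight_pos hL hK hLpos hdens hα hτ y
  rw [hpm]
  field_simp
  ring

end OneGroup

/-! ### Posterior means for small `τ` -/

section Limits

variable {K a α : ℝ} {L : ℝ → ℝ}

/-- As `τ → 0`, the posterior mean of `1 - κ` at the count `0` tends to `0`. -/
lemma tendsto_one_sub_posteriorMean_zero (hL : Measurable L) (hK : 0 < K)
    (hLpos : ∀ x, 0 < x → 0 < L x)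
    (hdens : ∫⁻ x in Ioi (0 : ℝ), ENNReal.ofReal (localDensity K a L x) = 1) (hα : 0 < α) :
    Tendsto (fun τ => 1 - posteriorMean K a L α τ 0) (𝓝[>] 0) (𝓝 0) := by
  have hlim : ∀ m : ℕ, Tendsto (fun τ => priorWeight K a L α τ m) (𝓝[>] 0)
      (𝓝 (∫ x in Ioi 0, localDensity K a L x * countWeight α m 0)) := by
    intro m
    refine tendsto_integral_filter_of_dominated_convergence (localDensity K a L) ?_ ?_
      (integrableOn_localDensity hL hK hLpos hdens) ?_
    · exact Eventually.of_forall fun τ => ((measurable_localDensity hL).mul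
        ((measurable_countWeight α m).comp (by fun_prop))).aestronglyMeasurable
    · refine Eventually.of_forall fun τ => ?_
      filter_upwards [ae_restrict_mem measurableSet_Ioi] with x hx
      have hx : 0 < x := hx
      have h1 := localDensity_pos (a := a) hK hLpos hx
      have h2 := countWeight_le_one hα m (u := x * τ ^ 2) (by positivity)
      have h3 : 0 ≤ countWeight α m (x * τ ^ 2) := by unfold countWeight; positivity
      rw [Real.norm_of_nonneg (by positivity)]
      exact mul_le_of_le_one_right h1.le h2
    · refine Eventually.of_forall fun x => Tendsto.const_mul _ ?_
      have hc : ContinuousAt (countWeight α m) 0 := by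
        unfold countWeight
        refine ContinuousAt.mul ((ContinuousAt.div continuousAt_id (by fun_prop) (by simp)).pow m)
          (ContinuousAt.rpow_const (by fun_prop) (by simp))
      have hu : Tendsto (fun τ : ℝ => x * τ ^ 2) (𝓝[>] 0) (𝓝 0) := by
        have : Continuous fun τ : ℝ => x * τ ^ 2 := by fun_prop
        simpa using (this.tendsto 0).mono_left nhdsWithin_le_nhds
      exact hc.tendsto.comp hu
  have h0 := hlim 0
  have h1 := hlim 1
  have e0 : ∫ x in Ioi 0, localDensity K a L x * countWeight α 0 0 = 1 := by
    simpa [countWeight] using integral_localDensity hL hK hLpos hdens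
  have e1 : ∫ x in Ioi 0, localDensity K a L x * countWeight α 1 0 = 0 := by
    simp [countWeight]
  rw [e0] at h0
  rw [e1] at h1
  have := h1.div h0 one_ne_zero
  rw [zero_div] at this
  refine this.congr' ?_
  filter_upwards [self_mem_nhdsWithin] with τ hτ
  exact (one_sub_posteriorMean hL hK hLpos hdens hα hτ 0).symm

/-- The Beta integral `∫ u ^ (m - a - 1) * (1 + u) ^ (-(m + α))` over `(0, ∞)`. -/
noncomputable def betaWeight (a α : ℝ) (m : ℕ) : ℝ :=
  ∫ u in Ioi 0, u ^ (-a - 1) * countWeight α m u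

lemma integrableOn_betaWeight (ha : 0 < a) (hα : 0 < α) {m : ℕ} (hm : a < m) :
    IntegrableOn (fun u : ℝ => u ^ (-a - 1) * countWeight α m u) (Ioi 0) := by
  have hmeas : Measurable fun u : ℝ => u ^ (-a - 1) * countWeight α m u :=
    (by fun_prop : Measurable fun u : ℝ => u ^ (-a - 1)).mul (measurable_countWeight α m)
  rw [← Ioc_union_Ioi_eq_Ioi (zero_le_one' ℝ)]
  refine IntegrableOn.union ?_ ?_
  · have hi : IntegrableOn (fun u : ℝ => u ^ ((m : ℝ) - a - 1)) (Ioc 0 1) := by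
      rw [← intervalIntegrable_iff_integrableOn_Ioc_of_le zero_le_one]
      exact intervalIntegral.intervalIntegrable_rpow' (by linarith)
    refine hi.mono' hmeas.aestronglyMeasurable ?_
    filter_upwards [ae_restrict_mem measurableSet_Ioc] with u hu
    have hu0 : 0 < u := hu.1
    have h3 := countWeight_pos (α := α) m hu0
    rw [Real.norm_of_nonneg (by positivity)]
    have e : u ^ ((m : ℝ) - a - 1) = u ^ (-a - 1) * u ^ m := by
      rw [← Real.rpow_natCast, ← Real.rpow_add hu0]; congr 1; ring
    rw [e]
    gcongr
    unfold countWeight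
    have h1 : (u / (1 + u)) ^ m ≤ u ^ m :=
      pow_le_pow_left₀ (by positivity) (div_le_self hu0.le (by linarith)) m
    have h2 : (1 + u) ^ (-α) ≤ 1 :=
      Real.rpow_le_one_of_one_le_of_nonpos (by linarith) (by linarith)
    calc _ ≤ u ^ m * 1 := by gcongr
      _ = u ^ m := mul_one _
  · have hi : IntegrableOn (fun u : ℝ => u ^ (-a - 1)) (Ioi 1) :=
      integrableOn_Ioi_rpow_of_lt (by linarith) one_pos
    refine hi.mono' hmeas.aestronglyMeasurable ?_
    filter_upwards [ae_restrict_mem measurableSet_Ioi] with u hu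
    have hu0 : 0 < u := one_pos.trans hu
    have h3 := countWeight_pos (α := α) m hu0
    rw [Real.norm_of_nonneg (by positivity)]
    exact mul_le_of_le_one_right (by positivity) (countWeight_le_one hα m hu0.le)

lemma betaWeight_pos (ha : 0 < a) (hα : 0 < α) {m : ℕ} (hm : a < m) : 0 < betaWeight a α m := by
  have hpos : ∀ u ∈ Ioi (0 : ℝ), 0 < u ^ (-a - 1) * countWeight α m u :=
    fun u hu => mul_pos (Real.rpow_pos_of_pos hu _) (countWeight_pos m hu)
  rw [betaWeight, setIntegral_pos_iff_support_of_nonneg_ae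
    ((ae_restrict_mem measurableSet_Ioi).mono fun u hu => (hpos u hu).le)
    (integrableOn_betaWeight ha hα hm)]
  have hsub : Ioi 0 ⊆ Function.support fun u : ℝ => u ^ (-a - 1) * countWeight α m u :=
    fun u hu => (hpos u hu).ne'
  rw [inter_eq_right.2 hsub]
  simp

/-- Integration by parts: the derivative of `u ^ (y - a) * (1 + u) ^ (-(y + α))` has integral `0`
over `(0, ∞)`. -/
lemma betaWeight_succ (ha : 0 < a) (hα : 0 < α) {y : ℕ} (hy : a < y) :
    (y + α) * betaWeight a α (y + 1) = (y - a) * betaWeight a α y := by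
  have hy1 : a < ((y + 1 : ℕ) : ℝ) := by push_cast; linarith
  have i0 := integrableOn_betaWeight ha hα hy
  have i1 := integrableOn_betaWeight ha hα hy1
  set F : ℝ → ℝ := fun u => u ^ ((y : ℝ) - a) * (1 + u) ^ (-(y + α)) with hF
  have hFe : ∀ u : ℝ, 0 < u → F u = u ^ (-a) * countWeight α y u := by
    intro u hu
    have e1 : u ^ ((y : ℝ) - a) = u ^ y * u ^ (-a) := by
      rw [sub_eq_add_neg, Real.rpow_add hu, Real.rpow_natCast]
    have e2 : (1 + u) ^ (-(y + α)) = ((1 + u) ^ y)⁻¹ * (1 + u) ^ (-α) := by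
      rw [neg_add, Real.rpow_add (by positivity), Real.rpow_neg (by positivity), Real.rpow_natCast]
    simp only [hF, countWeight, e1, e2, div_pow]
    ring
  have hcont : ContinuousWithinAt F (Ici 0) 0 := by
    refine ContinuousAt.continuousWithinAt ?_
    exact (Real.continuousAt_rpow_const 0 _ (Or.inr (by linarith))).mul
      (ContinuousAt.rpow_const (by fun_prop) (by simp))
  have hder : ∀ u ∈ Ioi (0 : ℝ), HasDerivAt F
      ((y - a) * (u ^ (-a - 1) * countWeight α y u) -
        (y + α) * (u ^ (-a - 1) * countWeight α (y + 1) u)) u := by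
    intro u hu
    have hu : 0 < u := hu
    have hu1 : 0 < 1 + u := by positivity
    have d1 : HasDerivAt (fun u : ℝ => u ^ ((y : ℝ) - a)) (((y : ℝ) - a) * u ^ ((y : ℝ) - a - 1)) u :=
      Real.hasDerivAt_rpow_const (Or.inl hu.ne')
    have d2 : HasDerivAt (fun u : ℝ => (1 + u) ^ (-((y : ℝ) + α)))
        (1 * (-((y : ℝ) + α)) * (1 + u) ^ (-((y : ℝ) + α) - 1)) u :=
      ((hasDerivAt_id u).const_add 1).rpow_const (Or.inl hu1.ne')
    convert! d1.mul d2 using 1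
    have e1 : u ^ ((y : ℝ) - a) = u ^ y * (u * u ^ (-a - 1)) := by
      rw [← Real.rpow_one_add' hu.le (by linarith), sub_eq_add_neg, Real.rpow_add hu,
        Real.rpow_natCast]
      congr 2; ring
    have e0 : u ^ ((y : ℝ) - a - 1) = u ^ y * u ^ (-a - 1) := by
      rw [← Real.rpow_natCast, ← Real.rpow_add hu]; congr 1; ring
    have e2 : (1 + u) ^ (-((y : ℝ) + α)) = ((1 + u) ^ y)⁻¹ * (1 + u) ^ (-α) := by
      rw [neg_add, Real.rpow_add (by positivity), Real.rpow_neg (by positivity), Real.rpow_natCast]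
    have e3 : (1 + u) ^ (-((y : ℝ) + α) - 1) = ((1 + u) ^ y)⁻¹ * (1 + u) ^ (-α) / (1 + u) := by
      rw [Real.rpow_sub_one hu1.ne', e2]
    rw [countWeight_succ, e0, e1, e2, e3]
    simp only [countWeight, div_pow]
    field_simp
    ring
  have htop : Tendsto F atTop (𝓝 0) := by
    refine squeeze_zero' ?_ ?_ (tendsto_rpow_neg_atTop ha)
    · filter_upwards [eventually_gt_atTop 0] with u hu
      simp only [hF]; positivity
    · filter_upwards [eventually_gt_atTop 0] with u hu
      rw [hFe u hu]
      exact mul_le_of_le_one_right (by positivity) (countWeight_le_one hα y hu.le)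
  have hint := integral_Ioi_of_hasDerivAt_of_tendsto hcont hder
    ((i0.const_mul _).sub (i1.const_mul _)) htop
  have hF0 : F 0 = 0 := by
    simp only [hF]
    rw [Real.zero_rpow (by linarith), zero_mul]
  rw [integral_sub (i0.const_mul _) (i1.const_mul _), integral_const_mul, integral_const_mul, hF0,
    sub_zero] at hint
  unfold betaWeight
  linarith

/-- The substitution `u = λ² τ²` in `priorWeight`. -/
lemma priorWeight_eq {τ : ℝ} (hτ : 0 < τ) (m : ℕ) :
    priorWeight K a L α τ m = K * (τ ^ 2) ^ a *
      ∫ u in Ioi 0, L (u / τ ^ 2) * (u ^ (-a - 1) * countWeight α m u) := by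
  have ht : 0 < τ ^ 2 := by positivity
  have h := integral_comp_mul_right_Ioi
    (fun u => localDensity K a L (u / τ ^ 2) * countWeight α m u) 0 ht
  rw [zero_mul] at h
  have e : priorWeight K a L α τ m =
      ∫ x in Ioi 0, localDensity K a L (x * τ ^ 2 / τ ^ 2) * countWeight α m (x * τ ^ 2) := by
    simp only [priorWeight, mul_div_cancel_right₀ _ ht.ne']
  rw [e, h, smul_eq_mul, ← integral_const_mul, ← integral_const_mul]
  refine setIntegral_congr_fun measurableSet_Ioi fun u hu => ?_
  have hu : 0 < u := hu
  have e2 : (u / τ ^ 2) ^ (-a - 1) = u ^ (-a - 1) * ((τ ^ 2) ^ a * τ ^ 2) := by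
    rw [Real.div_rpow hu.le ht.le, ← Real.rpow_add_one ht.ne', div_eq_mul_inv,
      ← Real.rpow_neg ht.le]
    congr 2; ring
  simp only [localDensity, e2]
  field_simp

/-- Dominated convergence, with `L (u / τ ^ 2) → l` pointwise and `L ≤ M`. -/
lemma tendsto_scaled_betaWeight (hL : Measurable L) (hLpos : ∀ x, 0 < x → 0 < L x) {l M : ℝ}
    (hl : Tendsto L atTop (𝓝 l)) (hM : ∀ t, 0 < t → L t ≤ M) (ha : 0 < a) (hα : 0 < α)
    {m : ℕ} (hm : a < m) :
    Tendsto (fun τ : ℝ => ∫ u in Ioi 0, L (u / τ ^ 2) * (u ^ (-a - 1) * countWeight α m u))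
      (𝓝[>] 0) (𝓝 (l * betaWeight a α m)) := by
  rw [betaWeight, ← integral_const_mul]
  have hmeas : Measurable fun u : ℝ => u ^ (-a - 1) * countWeight α m u :=
    (by fun_prop : Measurable fun u : ℝ => u ^ (-a - 1)).mul (measurable_countWeight α m)
  refine tendsto_integral_filter_of_dominated_convergence
    (fun u => M * (u ^ (-a - 1) * countWeight α m u)) ?_ ?_
    ((integrableOn_betaWeight ha hα hm).const_mul M) ?_
  · exact Eventually.of_forall fun τ =>
      ((hL.comp (by fun_prop : Measurable fun u : ℝ => u / τ ^ 2)).mul hmeas).aestronglyMeasurable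
  · filter_upwards [self_mem_nhdsWithin] with τ hτ
    have hτ : 0 < τ := hτ
    filter_upwards [ae_restrict_mem measurableSet_Ioi] with u hu
    have hu : 0 < u := hu
    have h1 := hLpos (u / τ ^ 2) (by positivity)
    have h2 := hM (u / τ ^ 2) (by positivity)
    have h3 := countWeight_pos (α := α) m hu
    rw [Real.norm_of_nonneg (by positivity)]
    gcongr
  · filter_upwards [ae_restrict_mem measurableSet_Ioi] with u hu
    have hu : 0 < u := hu
    refine Tendsto.mul_const _ (hl.comp ?_)
    have h1 : Tendsto (fun τ : ℝ => τ ^ 2) (𝓝[>] 0) (𝓝[>] 0) := by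
      refine tendsto_nhdsWithin_iff.2 ⟨?_, ?_⟩
      · have : Continuous fun τ : ℝ => τ ^ 2 := by fun_prop
        simpa using (this.tendsto 0).mono_left nhdsWithin_le_nhds
      · filter_upwards [self_mem_nhdsWithin] with τ hτ
        have hτ : 0 < τ := hτ
        exact pow_pos hτ 2
    exact ((tendsto_inv_nhdsGT_zero.comp h1).const_mul_atTop hu).congr fun τ =>
      (div_eq_mul_inv _ _).symm

/-- As `τ → 0`, the posterior mean of `1 - κ` at a count `y > a` tends to `(y - a) / (y + α)`. -/
lemma tendsto_one_sub_posteriorMean (hL : Measurable L) (hK : 0 < K)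
    (hLpos : ∀ x, 0 < x → 0 < L x)
    (hdens : ∫⁻ x in Ioi (0 : ℝ), ENNReal.ofReal (localDensity K a L x) = 1) {l M : ℝ}
    (hl0 : 0 < l) (hl : Tendsto L atTop (𝓝 l)) (hM : ∀ t, 0 < t → L t ≤ M) (ha : 0 < a)
    (hα : 0 < α) {y : ℕ} (hy : a < y) :
    Tendsto (fun τ => 1 - posteriorMean K a L α τ y) (𝓝[>] 0) (𝓝 ((y - a) / (y + α))) := by
  have hy1 : a < ((y + 1 : ℕ) : ℝ) := by push_cast; linarith
  have hB := betaWeight_pos ha hα hy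
  have hya : 0 < (y : ℝ) + α := by positivity
  have h := (tendsto_scaled_betaWeight hL hLpos hl hM ha hα hy1).div
    (tendsto_scaled_betaWeight hL hLpos hl hM ha hα hy) (by positivity)
  have e : l * betaWeight a α (y + 1) / (l * betaWeight a α y) = (y - a) / (y + α) := by
    rw [mul_div_mul_left _ _ hl0.ne', div_eq_div_iff hB.ne' hya.ne', ← betaWeight_succ ha hα hy]
    ring
  rw [e] at h
  refine h.congr' ?_
  filter_upwards [self_mem_nhdsWithin] with τ hτ
  have hτ : 0 < τ := hτ
  rw [one_sub_posteriorMean hL hK hLpos hdens hα hτ, priorWeight_eq hτ, priorWeight_eq hτ,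
    mul_div_mul_left _ _ (by positivity)]
  rfl

/-- For all small `τ` the one-group rule accepts at the count `0` and rejects at every count `y ≤ N`
above the limiting threshold. -/
lemma exists_decision_threshold {δ : ℝ} (hδ : 0 < δ) (hL : Measurable L) (hK : 0 < K)
    (hLpos : ∀ x, 0 < x → 0 < L x)
    (hdens : ∫⁻ x in Ioi (0 : ℝ), ENNReal.ofReal (localDensity K a L x) = 1) {l M : ℝ}
    (hl0 : 0 < l) (hl : Tendsto L atTop (𝓝 l)) (hM : ∀ t, 0 < t → L t ≤ M) (ha : 0 < a)
    (hα : 0 < α) (N : ℕ) :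
    ∃ τ₀ : ℝ, 0 < τ₀ ∧ ∀ τ, 0 < τ → τ ≤ τ₀ →
      1 - posteriorMean K a L α τ 0 ≤ δ / (2 * (δ + 1)) ∧
      ∀ y : ℕ, y ≤ N → 2 * a + α - 2 * (a + α) / (δ + 2) < y →
        δ / (2 * (δ + 1)) < 1 - posteriorMean K a L α τ y := by
  have hc : 0 < δ / (2 * (δ + 1)) := by positivity
  have h0 : ∀ᶠ τ in 𝓝[>] 0, 1 - posteriorMean K a L α τ 0 ≤ δ / (2 * (δ + 1)) :=
    (tendsto_one_sub_posteriorMean_zero hL hK hLpos hdens hα).eventually_le_const hc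
  have h1 : ∀ y : ℕ, ∀ᶠ τ in 𝓝[>] 0, 2 * a + α - 2 * (a + α) / (δ + 2) < y →
      δ / (2 * (δ + 1)) < 1 - posteriorMean K a L α τ y := by
    intro y
    by_cases hT : 2 * a + α - 2 * (a + α) / (δ + 2) < y
    · have e : 2 * a + α - 2 * (a + α) / (δ + 2) = (2 * (δ + 1) * a + δ * α) / (δ + 2) := by
        field_simp; ring
      rw [e, div_lt_iff₀ (by positivity)] at hT
      -- the level `(2 (δ + 1) a + δ α) / (δ + 2)` is larger than `a`
      have hy : a < y := by nlinarith [mul_pos hδ ha, mul_pos hδ hα]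
      have hlt : δ / (2 * (δ + 1)) < (y - a) / (y + α) := by
        rw [div_lt_div_iff₀ (by positivity) (by positivity)]
        nlinarith
      filter_upwards [(tendsto_one_sub_posteriorMean hL hK hLpos hdens hl0 hl hM ha hα
        hy).eventually_const_lt hlt] with τ hτ _
      exact hτ
    · exact Eventually.of_forall fun _ h => absurd h hT
  have h2 : ∀ᶠ τ in 𝓝[>] 0, ∀ y ∈ Finset.range (N + 1),
      2 * a + α - 2 * (a + α) / (δ + 2) < y → δ / (2 * (δ + 1)) < 1 - posteriorMean K a L α τ y :=
    (Finset.eventually_all _).2 fun y _ => h1 y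
  obtain ⟨u, hu, hsub⟩ := mem_nhdsGT_iff_exists_Ioc_subset.1 (h0.and h2)
  refine ⟨u, hu, fun τ hτ hτu => ⟨(hsub ⟨hτ, hτu⟩).1, fun y hy => ?_⟩⟩
  exact (hsub ⟨hτ, hτu⟩).2 y (Finset.mem_range.2 (by omega))

end Limits

/-! ### Negative binomial probabilities -/

lemma negBinomialPMF_zero {α q : ℝ} (hα : 0 < α) : negBinomialPMF α q 0 = q ^ α := by
  have : Real.Gamma α ≠ 0 := (Real.Gamma_pos_of_pos hα).ne'
  simp [negBinomialPMF, this]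

lemma negBinomial_real_finset {α s : ℝ} (hα : 0 < α) (hs : 0 < s) (F : Finset ℕ) :
    (negBinomial α (1 / (1 + s))).real F = ∑ y ∈ F, negBinomialPMF α (1 / (1 + s)) y := by
  have := isProbabilityMeasure_negBinomial hα hs
  rw [← sum_measureReal_singleton F]
  refine Finset.sum_congr rfl fun y _ => ?_
  rw [measureReal_def, negBinomial_singleton, ENNReal.toReal_ofReal]
  exact negBinomialPMF_nonneg hα (by positivity) ((div_le_one (by linarith)).2 (by linarith)) y

lemma tendsto_negBinomial_real_finset {α s : ℝ} (hα : 0 < α) (hs : 0 < s) (F : Finset ℕ)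
    {σ : ℕ → ℝ} (hσ : Tendsto σ atTop (𝓝 s)) :
    Tendsto (fun n => (negBinomial α (1 / (1 + σ n))).real F) atTop
      (𝓝 ((negBinomial α (1 / (1 + s))).real F)) := by
  rw [negBinomial_real_finset hα hs]
  have hq : Tendsto (fun n => 1 / (1 + σ n)) atTop (𝓝 (1 / (1 + s))) :=
    tendsto_const_nhds.div (hσ.const_add 1) (by positivity)
  have hsum : Tendsto (fun n => ∑ y ∈ F, negBinomialPMF α (1 / (1 + σ n)) y) atTop
      (𝓝 (∑ y ∈ F, negBinomialPMF α (1 / (1 + s)) y)) := by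
    refine tendsto_finsetSum F fun y _ => ?_
    unfold negBinomialPMF
    refine (Tendsto.const_mul _ ((hq.const_sub 1).pow y)).mul (hq.rpow_const ?_)
    exact Or.inl (by positivity)
  refine hsum.congr' ?_
  filter_upwards [hσ.eventually_const_lt hs] with n hn
  exact (negBinomial_real_finset hα hn F).symm

lemma tendsto_negBinomial_real_compl {α s : ℝ} (hα : 0 < α) (hs : 0 < s) (F : Finset ℕ)
    {σ : ℕ → ℝ} (hσ : Tendsto σ atTop (𝓝 s)) :
    Tendsto (fun n => (negBinomial α (1 / (1 + σ n))).real (F : Set ℕ)ᶜ) atTop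
      (𝓝 ((negBinomial α (1 / (1 + s))).real (F : Set ℕ)ᶜ)) := by
  have := isProbabilityMeasure_negBinomial hα hs
  rw [probReal_compl_eq_one_sub (.of_discrete)]
  refine ((tendsto_negBinomial_real_finset hα hs F hσ).const_sub 1).congr' ?_
  filter_upwards [hσ.eventually_const_lt hs] with n hn
  have := isProbabilityMeasure_negBinomial hα hn
  rw [probReal_compl_eq_one_sub (.of_discrete)]

lemma negBinomial_real_zero {α s : ℝ} (hα : 0 < α) (hs : 0 < s) :
    (negBinomial α (1 / (1 + s))).real {0} = (1 + s) ^ (-α) := by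
  have h := negBinomial_real_finset hα hs {0}
  rw [Finset.coe_singleton, Finset.sum_singleton, negBinomialPMF_zero hα] at h
  rw [h, one_div, Real.inv_rpow (by positivity), Real.rpow_neg (by positivity)]

lemma negBinomial_real_pos_le {α s : ℝ} (hα : 0 < α) (hs : 0 < s) :
    (negBinomial α (1 / (1 + s))).real {y | 1 ≤ y} ≤ α * s := by
  have := isProbabilityMeasure_negBinomial hα hs
  have e : {y : ℕ | 1 ≤ y} = {0}ᶜ := by
    ext y; simp [Nat.one_le_iff_ne_zero]
  rw [e, probReal_compl_eq_one_sub (.of_discrete), negBinomial_real_zero hα hs,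
    Real.rpow_def_of_pos (by positivity)]
  have h1 := Real.add_one_le_exp (Real.log (1 + s) * -α)
  have h2 := Real.log_le_sub_one_of_pos (show 0 < 1 + s by positivity)
  nlinarith

/-! ### Second moments and joint probabilities in the sample -/

/-- A second-moment bound for the number of coordinates of an i.i.d. sample that lie in `A`. -/
lemma pi_real_card_gt_le {X : Type*} [MeasurableSpace X] (ν : Measure X) [IsProbabilityMeasure ν]
    {A : Set X} (hA : MeasurableSet A) (n : ℕ) {c : ℝ} (hc : 0 < c) :
    (Measure.pi fun _ : Fin n => ν).real
        {ω | c < ∑ i, (Function.eval i ⁻¹' A).indicator (fun _ => (1 : ℝ)) ω} ≤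
      (n * ν.real A + n ^ 2 * ν.real A ^ 2) / c ^ 2 := by
  set μ := Measure.pi fun _ : Fin n => ν
  set E : Fin n → Set (Fin n → X) := fun i => Function.eval i ⁻¹' A
  have hE : ∀ i, MeasurableSet (E i) := fun i => measurable_pi_apply i hA
  have hμE : ∀ i, μ.real (E i) = ν.real A := fun i => by
    rw [measureReal_def, (measurePreserving_eval (fun _ : Fin n => ν) i).measure_preimage
      hA.nullMeasurableSet, measureReal_def]
  -- pairwise independence is all that the second moment needs
  have hpair : ∀ i j, μ.real (E i ∩ E j) ≤ (if i = j then ν.real A else 0) + ν.real A ^ 2 := by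
    intro i j
    split_ifs with hij
    · subst hij
      rw [inter_self, hμE]
      nlinarith [sq_nonneg (ν.real A)]
    · have hind : iIndepFun (fun (i : Fin n) (ω : Fin n → X) => ω i) μ :=
        iIndepFun_pi (X := fun _ => id) fun _ => aemeasurable_id
      have := (hind.indepFun hij).measure_inter_preimage_eq_mul A A hA hA
      rw [measureReal_def, show μ (E i ∩ E j) = μ (E i) * μ (E j) from this, ENNReal.toReal_mul,
        ← measureReal_def, ← measureReal_def, hμE, hμE]
      exact le_of_eq (by ring)
  set S : (Fin n → X) → ℝ := fun ω => ∑ i, (E i).indicator (fun _ => (1 : ℝ)) ω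
  have hS2 : ∀ ω, S ω ^ 2 = ∑ i, ∑ j, (E i ∩ E j).indicator (fun _ => (1 : ℝ)) ω := by
    intro ω
    rw [sq, Finset.sum_mul_sum]
    refine Finset.sum_congr rfl fun i _ => Finset.sum_congr rfl fun j _ => ?_
    by_cases hi : ω ∈ E i <;> by_cases hj : ω ∈ E j <;> simp [hi, hj]
  have hint : ∀ i j, Integrable ((E i ∩ E j).indicator fun _ => (1 : ℝ)) μ := fun i j =>
    (integrable_const _).indicator ((hE i).inter (hE j))
  have hSint : Integrable (fun ω => S ω ^ 2) μ := by
    simp_rw [hS2]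
    exact integrable_finsetSum _ fun i _ => integrable_finsetSum _ fun j _ => hint i j
  have hS2le : ∫ ω, S ω ^ 2 ∂μ ≤ n * ν.real A + n ^ 2 * ν.real A ^ 2 := by
    simp_rw [hS2]
    rw [integral_finsetSum _ fun i _ => integrable_finsetSum _ fun j _ => hint i j]
    simp_rw [integral_finsetSum _ fun j _ => hint _ j,
      integral_indicator_const _ ((hE _).inter (hE _)), smul_eq_mul, mul_one]
    calc ∑ i, ∑ j, μ.real (E i ∩ E j)
        ≤ ∑ i : Fin n, ∑ j : Fin n, ((if i = j then ν.real A else 0) + ν.real A ^ 2) :=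
          Finset.sum_le_sum fun i _ => Finset.sum_le_sum fun j _ => hpair i j
      _ = n * ν.real A + n ^ 2 * ν.real A ^ 2 := by
          simp [Finset.sum_add_distrib]
          ring
  have hmk := mul_meas_ge_le_integral_of_nonneg (μ := μ)
    (Eventually.of_forall fun ω => sq_nonneg (S ω)) hSint (c ^ 2)
  rw [le_div_iff₀ (by positivity), mul_comm]
  refine le_trans ?_ (hmk.trans hS2le)
  refine mul_le_mul_of_nonneg_left (measureReal_mono fun ω hω => ?_) (by positivity)
  have hω : c < S ω := hω
  exact pow_le_pow_left₀ hc.le hω.le 2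

section TwoGroup

variable {p α β δ : ℝ} {n : ℕ}

lemma groupScale_pos (hβ : 0 < β) (hδ : 0 < δ) (b : Bool) : 0 < groupScale β δ b := by
  cases b <;> simp [groupScale] <;> positivity

lemma groupWeight_pos (hp : 0 < p) (hp1 : p < 1) (b : Bool) : 0 < groupWeight p b := by
  cases b <;> simp [groupWeight] <;> linarith

lemma isProbabilityMeasure_twoGroupModel (hp : 0 < p) (hp1 : p < 1) :
    IsProbabilityMeasure (twoGroupModel n p α β δ) := by
  have := isProbabilityMeasure_twoGroupLaw (α := α) (β := β) (δ := δ) hp hp1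
  unfold twoGroupModel
  infer_instance

lemma measurableSet_latent (i : Fin n) (b : Bool) :
    MeasurableSet {ω : Fin n → (Bool × ℝ) × ℕ | latent ω i = b} := by
  have : Measurable fun ω : Fin n → (Bool × ℝ) × ℕ => (ω i).1.1 := by fun_prop
  exact this (measurableSet_singleton b)

lemma twoGroupModel_real (hp : 0 < p) (hp1 : p < 1) (hα : 0 < α) (hβ : 0 < β)
    (hδ : 0 < δ) (i : Fin n) (b : Bool) (A : Set ℕ) :
    (twoGroupModel n p α β δ).real {ω | latent ω i = b ∧ counts ω i ∈ A} =
      groupWeight p b * (negBinomial α (1 / (1 + groupScale β δ b))).real A := by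
  have := isProbabilityMeasure_twoGroupLaw (α := α) (β := β) (δ := δ) hp hp1
  have hm : MeasurableSet {x : (Bool × ℝ) × ℕ | x.1.1 = b ∧ x.2 ∈ A} :=
    (measurable_fst (measurable_fst (measurableSet_singleton b))).inter
      (measurable_snd (.of_discrete))
  have h := (measurePreserving_eval (fun _ : Fin n => twoGroupLaw p α β δ) i).measure_preimage
    hm.nullMeasurableSet
  rw [twoGroupLaw_apply hα hβ hδ] at h
  have h' : twoGroupModel n p α β δ {ω | latent ω i = b ∧ counts ω i ∈ A} = _ := h
  rw [measureReal_def, h', ENNReal.toReal_mul,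
    ENNReal.toReal_ofReal (groupWeight_pos hp hp1 b).le, measureReal_def]

lemma twoGroupModel_real_latent (hp : 0 < p) (hp1 : p < 1) (hα : 0 < α) (hβ : 0 < β)
    (hδ : 0 < δ) (i : Fin n) (b : Bool) :
    (twoGroupModel n p α β δ).real {ω | latent ω i = b} = groupWeight p b := by
  have := isProbabilityMeasure_negBinomial hα (groupScale_pos hβ hδ b)
  have h := twoGroupModel_real hp hp1 hα hβ hδ i b univ
  rw [probReal_univ, mul_one] at h
  simpa using h

/-- The Bayes risk as a sum of joint probabilities. -/
lemma bayesRisk_eq (hp : 0 < p) (hp1 : p < 1) (hα : 0 < α) (hβ : 0 < β) (hδ : 0 < δ)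
    (reject : (Fin n → ℕ) → Set (Fin n)) :
    bayesRisk n p α β δ reject =
      ∑ i, ((twoGroupModel n p α β δ).real {ω | latent ω i = false ∧ i ∈ reject (counts ω)} +
        (twoGroupModel n p α β δ).real {ω | latent ω i = true ∧ i ∉ reject (counts ω)}) := by
  have hcond : ∀ (i : Fin n) (b : Bool) (s : Set (Fin n → (Bool × ℝ) × ℕ)),
      groupWeight p b *
        (ProbabilityTheory.cond (twoGroupModel n p α β δ) {ω | latent ω i = b}).real s =
      (twoGroupModel n p α β δ).real ({ω | latent ω i = b} ∩ s) := by
    intro i b s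
    have hw := twoGroupModel_real_latent (n := n) hp hp1 hα hβ hδ i b
    have h0 := (groupWeight_pos hp hp1 b).ne'
    rw [measureReal_def, cond_apply (measurableSet_latent i b), ENNReal.toReal_mul,
      ENNReal.toReal_inv, ← measureReal_def, ← measureReal_def, hw]
    field_simp
  refine Finset.sum_congr rfl fun i _ => ?_
  have h1 := hcond i false {ω | i ∈ reject (counts ω)}
  have h2 := hcond i true {ω | i ∉ reject (counts ω)}
  simp only [groupWeight, if_true, Bool.false_eq_true, if_false] at h1 h2
  rw [typeIError, typeIIError, h1, h2]
  rfl

lemma twoGroupLaw_real_pos_le (hp : 0 < p) (hp1 : p < 1) (hα : 0 < α) (hβ : 0 < β)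
    (hδ : 0 < δ) : (twoGroupLaw p α β δ).real {x | 1 ≤ x.2} ≤ α * β + p := by
  have := isProbabilityMeasure_twoGroupLaw (α := α) (β := β) (δ := δ) hp hp1
  have hb : ∀ b, (twoGroupLaw p α β δ).real {x | x.1.1 = b ∧ x.2 ∈ {y | 1 ≤ y}} =
      groupWeight p b * (negBinomial α (1 / (1 + groupScale β δ b))).real {y | 1 ≤ y} := by
    intro b
    rw [measureReal_def, twoGroupLaw_apply hα hβ hδ, ENNReal.toReal_mul,
      ENNReal.toReal_ofReal (groupWeight_pos hp hp1 b).le, measureReal_def]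
  have hsub : {x : (Bool × ℝ) × ℕ | 1 ≤ x.2} ⊆ {x | x.1.1 = false ∧ x.2 ∈ {y | 1 ≤ y}} ∪
      {x | x.1.1 = true ∧ x.2 ∈ {y | 1 ≤ y}} := by
    rintro ⟨⟨b, θ⟩, y⟩ hy
    cases b
    · exact Or.inl ⟨rfl, hy⟩
    · exact Or.inr ⟨rfl, hy⟩
  refine ((measureReal_mono hsub).trans (measureReal_union_le _ _)).trans ?_
  rw [hb, hb]
  have := isProbabilityMeasure_negBinomial hα (groupScale_pos hβ hδ true)
  have h1 := negBinomial_real_pos_le hα hβ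
  have h2 : (negBinomial α (1 / (1 + groupScale β δ true))).real {y | 1 ≤ y} ≤ 1 :=
    measureReal_le_one
  have h3 : 0 ≤ (negBinomial α (1 / (1 + β))).real {y | 1 ≤ y} := measureReal_nonneg
  simp only [groupWeight, groupScale, if_true, Bool.false_eq_true, if_false] at h2 ⊢
  nlinarith

/-- The proportion of positive counts exceeds a fixed level with small probability. -/
lemma twoGroupModel_real_tauHat_gt_le (hp : 0 < p) (hp1 : p < 1) (hα : 0 < α) (hβ : 0 < β)
    (hδ : 0 < δ) (hn : 0 < n) {τ₀ : ℝ} (hτ : 0 < τ₀) (hτn : 1 / (n : ℝ) ≤ τ₀) :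
    (twoGroupModel n p α β δ).real {ω | τ₀ < tauHat n (counts ω)} ≤
      ((α * β + p) / n + (α * β + p) ^ 2) / τ₀ ^ 2 := by
  have := isProbabilityMeasure_twoGroupLaw (α := α) (β := β) (δ := δ) hp hp1
  have := isProbabilityMeasure_twoGroupModel (n := n) (α := α) (β := β) (δ := δ) hp hp1
  have hn' : (0 : ℝ) < n := by exact_mod_cast hn
  have hA : MeasurableSet {x : (Bool × ℝ) × ℕ | 1 ≤ x.2} :=
    measurable_snd (.of_discrete (s := {y : ℕ | 1 ≤ y}))
  have hbd := pi_real_card_gt_le (twoGroupLaw p α β δ) hA n (c := n * τ₀) (by positivity)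
  have hq := twoGroupLaw_real_pos_le hp hp1 hα hβ hδ
  have hq0 : 0 ≤ (twoGroupLaw p α β δ).real {x | 1 ≤ x.2} := measureReal_nonneg
  set q := (twoGroupLaw p α β δ).real {x | 1 ≤ x.2}
  calc (twoGroupModel n p α β δ).real {ω | τ₀ < tauHat n (counts ω)}
      ≤ (n * q + n ^ 2 * q ^ 2) / (n * τ₀) ^ 2 := by
        refine le_trans (measureReal_mono ?_) hbd
        intro ω hω
        have hω : τ₀ < max (1 / (n : ℝ)) (1 / (n : ℝ) *
          ((Finset.univ.filter fun i => 1 ≤ counts ω i).card : ℝ)) := hω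
        have h2 := (lt_max_iff.1 hω).resolve_left (not_lt.2 hτn)
        have e : ∑ i, (Function.eval i ⁻¹' {x : (Bool × ℝ) × ℕ | 1 ≤ x.2}).indicator
            (fun _ => (1 : ℝ)) ω = ((Finset.univ.filter fun i => 1 ≤ counts ω i).card : ℝ) := by
          rw [Finset.card_filter]
          push_cast
          refine Finset.sum_congr rfl fun i _ => ?_
          by_cases h : 1 ≤ (ω i).2 <;> simp [counts, h]
        rw [mem_ofPred_eq, e]
        rw [one_div_mul_eq_div, lt_div_iff₀ hn'] at h2
        linarith
    _ = (q / n + q ^ 2) / τ₀ ^ 2 := by field_simp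
    _ ≤ _ := by gcongr

end TwoGroup

/-! ### Risks of the two rules -/

section Rules

variable {p α β δ : ℝ} {n : ℕ}

/-- When `β` is small compared with `p`, the Bayes Oracle threshold lies in `[0, 1)`. -/
lemma oracleThreshold_lt_natCast_iff (hp : 0 < p) (hp2 : p ≤ 1 / 2) (hα : 0 < α) (hβ : 0 < β)
    (hδ : 0 < δ) (hβp : β * ((1 + δ) ^ α * (1 + δ)) < δ * p) (k : ℕ) :
    oracleThreshold p α β δ < k ↔ 1 ≤ k := by
  have h1 : 0 ≤ Real.log ((1 - p) / p) :=
    Real.log_nonneg ((one_le_div hp).2 (by linarith))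
  have h2 : 0 ≤ Real.log ((β + δ + 1) / (β + 1)) :=
    Real.log_nonneg ((one_le_div (by positivity)).2 (by linarith))
  have hp1 : 0 < 1 - p := by linarith
  have hlt : Real.log ((1 - p) / p) + α * Real.log ((β + δ + 1) / (β + 1)) <
      Real.log (((β + δ) * (β + 1)) / (β * (β + δ + 1))) := by
    rw [← Real.log_rpow (by positivity), ← Real.log_mul (by positivity) (by positivity)]
    refine Real.log_lt_log (by positivity) ?_
    -- both sides are compared with their orders `1 / p` and `1 / β`
    calc (1 - p) / p * ((β + δ + 1) / (β + 1)) ^ α ≤ 1 / p * (1 + δ) ^ α := by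
          gcongr
          · linarith
          · rw [div_le_iff₀ (by positivity)]
            nlinarith [mul_pos hβ hδ]
      _ < δ / (β * (1 + δ)) := by
          rw [one_div_mul_eq_div, div_lt_div_iff₀ hp (by positivity)]
          linarith
      _ ≤ ((β + δ) * (β + 1)) / (β * (β + δ + 1)) := by
          rw [div_le_div_iff₀ (by positivity) (by positivity)]
          have : δ * (β + δ + 1) ≤ (β + δ) * (β + 1) * (1 + δ) := by
            nlinarith [mul_pos hβ hδ, mul_pos hβ hβ, mul_pos (mul_pos hβ hδ) hδ,
              mul_pos (mul_pos hβ hβ) hδ]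
          nlinarith [mul_le_mul_of_nonneg_left this hβ.le]
  have hnum : 0 ≤ Real.log ((1 - p) / p) + α * Real.log ((β + δ + 1) / (β + 1)) := by positivity
  have hden := hnum.trans_lt hlt
  have ht0 : 0 ≤ oracleThreshold p α β δ := div_nonneg hnum hden.le
  have ht1 : oracleThreshold p α β δ < 1 := (div_lt_one hden).2 hlt
  constructor
  · intro h
    exact_mod_cast ht0.trans_lt h
  · intro h
    exact ht1.trans_le (by exact_mod_cast h)

/-- For `β` small compared with `p`, the Oracle rejects exactly the nonzero counts. -/
lemma bayesRisk_oracleRule (hp : 0 < p) (hp2 : p ≤ 1 / 2) (hα : 0 < α) (hβ : 0 < β)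
    (hδ : 0 < δ) (hβp : β * ((1 + δ) ^ α * (1 + δ)) < δ * p) :
    bayesRisk n p α β δ (oracleRule n p α β δ) =
      n * ((1 - p) * (negBinomial α (1 / (1 + β))).real {y | 1 ≤ y} +
        p * (negBinomial α (1 / (1 + (β + δ)))).real {0}) := by
  have hp1 : p < 1 := by linarith
  rw [bayesRisk_eq hp hp1 hα hβ hδ]
  have hi : ∀ i : Fin n,
      (twoGroupModel n p α β δ).real
          {ω | latent ω i = false ∧ i ∈ oracleRule n p α β δ (counts ω)} +
        (twoGroupModel n p α β δ).real
          {ω | latent ω i = true ∧ i ∉ oracleRule n p α β δ (counts ω)} =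
      (1 - p) * (negBinomial α (1 / (1 + β))).real {y | 1 ≤ y} +
        p * (negBinomial α (1 / (1 + (β + δ)))).real {0} := by
    intro i
    have h1 := twoGroupModel_real hp hp1 hα hβ hδ i false {y | 1 ≤ y}
    have h2 := twoGroupModel_real hp hp1 hα hβ hδ i true {0}
    simp only [groupWeight, groupScale, if_true, Bool.false_eq_true, if_false] at h1 h2
    rw [← h1, ← h2]
    have hmem : ∀ ω : Fin n → (Bool × ℝ) × ℕ,
        i ∈ oracleRule n p α β δ (counts ω) ↔ 1 ≤ counts ω i :=
      fun ω => oracleThreshold_lt_natCast_iff hp hp2 hα hβ hδ hβp (counts ω i)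
    congr 2
    · ext ω
      simp only [mem_ofPred_eq, hmem]
    · ext ω
      simp only [mem_ofPred_eq, hmem, mem_singleton_iff]
      refine and_congr_right fun _ => by omega
  rw [Finset.sum_congr rfl fun i _ => hi i]
  simp only [Finset.sum_const, Finset.card_univ, Fintype.card_fin, nsmul_eq_mul]

lemma tauHat_pos (hn : 0 < n) (Y : Fin n → ℕ) : 0 < tauHat n Y :=
  lt_max_of_lt_left (one_div_pos.2 (by exact_mod_cast hn))

variable {K a : ℝ} {L : ℝ → ℝ} {τ₀ : ℝ}

/-- Lower bound for the risk of the empirical Bayes rule: zero counts are accepted unless the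
estimate of `τ` is large. -/
lemma le_bayesRisk_ebRule (hp : 0 < p) (hp1 : p < 1) (hα : 0 < α) (hβ : 0 < β) (hδ : 0 < δ)
    (hn : 0 < n)
    (hdec : ∀ τ, 0 < τ → τ ≤ τ₀ → 1 - posteriorMean K a L α τ 0 ≤ δ / (2 * (δ + 1))) :
    n * (p * (negBinomial α (1 / (1 + (β + δ)))).real {0} -
        (twoGroupModel n p α β δ).real {ω | τ₀ < tauHat n (counts ω)}) ≤
      bayesRisk n p α β δ (ebRule n K a L α δ) := by
  have := isProbabilityMeasure_twoGroupModel (n := n) (α := α) (β := β) (δ := δ) hp hp1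
  rw [bayesRisk_eq hp hp1 hα hβ hδ]
  set μ := twoGroupModel n p α β δ
  have hi : ∀ i : Fin n, p * (negBinomial α (1 / (1 + (β + δ)))).real {0} -
        μ.real {ω | τ₀ < tauHat n (counts ω)} ≤
      μ.real {ω | latent ω i = false ∧ i ∈ ebRule n K a L α δ (counts ω)} +
        μ.real {ω | latent ω i = true ∧ i ∉ ebRule n K a L α δ (counts ω)} := by
    intro i
    have h2 := twoGroupModel_real hp hp1 hα hβ hδ i true {0}
    simp only [groupWeight, groupScale, if_true] at h2
    rw [← h2]
    have hsub : {ω : Fin n → (Bool × ℝ) × ℕ | latent ω i = true ∧ counts ω i ∈ ({0} : Set ℕ)} ⊆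
        {ω | latent ω i = true ∧ i ∉ ebRule n K a L α δ (counts ω)} ∪
          {ω | τ₀ < tauHat n (counts ω)} := by
      rintro ω ⟨hl, hc⟩
      rcases lt_or_ge τ₀ (tauHat n (counts ω)) with h | h
      · exact Or.inr h
      · refine Or.inl ⟨hl, fun hr => ?_⟩
        have hr : δ / (2 * (δ + 1)) <
          1 - posteriorMean K a L α (tauHat n (counts ω)) (counts ω i) := hr
        rw [mem_singleton_iff.1 hc] at hr
        exact absurd hr (not_lt.2 (hdec _ (tauHat_pos hn _) h))
    have h3 := (measureReal_mono (μ := μ) hsub).trans (measureReal_union_le _ _)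
    have h4 : 0 ≤ μ.real {ω | latent ω i = false ∧ i ∈ ebRule n K a L α δ (counts ω)} :=
      measureReal_nonneg
    linarith
  calc _ = ∑ _i : Fin n, (p * (negBinomial α (1 / (1 + (β + δ)))).real {0} -
        μ.real {ω | τ₀ < tauHat n (counts ω)}) := by
        simp only [Finset.sum_const, Finset.card_univ, Fintype.card_fin, nsmul_eq_mul]
    _ ≤ _ := Finset.sum_le_sum fun i _ => hi i

/-- Upper bound for the risk of the empirical Bayes rule, when for small `τ` the rule accepts at the
count `0` and rejects at every count in `F`. -/
lemma bayesRisk_ebRule_le (hp : 0 < p) (hp1 : p < 1) (hα : 0 < α) (hβ : 0 < β) (hδ : 0 < δ)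
    (hn : 0 < n) (F : Set ℕ)
    (hdec : ∀ τ, 0 < τ → τ ≤ τ₀ → 1 - posteriorMean K a L α τ 0 ≤ δ / (2 * (δ + 1)))
    (hF : ∀ τ, 0 < τ → τ ≤ τ₀ → ∀ y ∈ F, δ / (2 * (δ + 1)) < 1 - posteriorMean K a L α τ y) :
    bayesRisk n p α β δ (ebRule n K a L α δ) ≤
      n * (α * β + p * (negBinomial α (1 / (1 + (β + δ)))).real Fᶜ +
        2 * (twoGroupModel n p α β δ).real {ω | τ₀ < tauHat n (counts ω)}) := by
  have := isProbabilityMeasure_twoGroupModel (n := n) (α := α) (β := β) (δ := δ) hp hp1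
  rw [bayesRisk_eq hp hp1 hα hβ hδ]
  set μ := twoGroupModel n p α β δ
  have hi : ∀ i : Fin n,
      μ.real {ω | latent ω i = false ∧ i ∈ ebRule n K a L α δ (counts ω)} +
        μ.real {ω | latent ω i = true ∧ i ∉ ebRule n K a L α δ (counts ω)} ≤
      α * β + p * (negBinomial α (1 / (1 + (β + δ)))).real Fᶜ +
        2 * μ.real {ω | τ₀ < tauHat n (counts ω)} := by
    intro i
    have h1 := twoGroupModel_real hp hp1 hα hβ hδ i false {y | 1 ≤ y}
    have h2 := twoGroupModel_real hp hp1 hα hβ hδ i true Fᶜ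
    simp only [groupWeight, groupScale, if_true, Bool.false_eq_true, if_false] at h1 h2
    rw [← h2]
    have hsub1 : {ω : Fin n → (Bool × ℝ) × ℕ | latent ω i = false ∧
        i ∈ ebRule n K a L α δ (counts ω)} ⊆
        {ω | latent ω i = false ∧ counts ω i ∈ {y | 1 ≤ y}} ∪
          {ω | τ₀ < tauHat n (counts ω)} := by
      rintro ω ⟨hl, hc⟩
      rcases lt_or_ge τ₀ (tauHat n (counts ω)) with h | h
      · exact Or.inr h
      · refine Or.inl ⟨hl, Nat.one_le_iff_ne_zero.2 fun h0 => ?_⟩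
        have hc : δ / (2 * (δ + 1)) <
          1 - posteriorMean K a L α (tauHat n (counts ω)) (counts ω i) := hc
        rw [h0] at hc
        exact absurd hc (not_lt.2 (hdec _ (tauHat_pos hn _) h))
    have hsub2 : {ω : Fin n → (Bool × ℝ) × ℕ | latent ω i = true ∧
        i ∉ ebRule n K a L α δ (counts ω)} ⊆
        {ω | latent ω i = true ∧ counts ω i ∈ Fᶜ} ∪ {ω | τ₀ < tauHat n (counts ω)} := by
      rintro ω ⟨hl, hc⟩
      rcases lt_or_ge τ₀ (tauHat n (counts ω)) with h | h
      · exact Or.inr h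
      · exact Or.inl ⟨hl, fun hyF => hc (hF _ (tauHat_pos hn _) h _ hyF)⟩
    have h3 := (measureReal_mono (μ := μ) hsub1).trans (measureReal_union_le _ _)
    have h4 := (measureReal_mono (μ := μ) hsub2).trans (measureReal_union_le _ _)
    have h5 := negBinomial_real_pos_le hα hβ
    have h6 : 0 ≤ (negBinomial α (1 / (1 + β))).real {y | 1 ≤ y} := measureReal_nonneg
    rw [h1] at h3
    have h7 : (1 - p) * (negBinomial α (1 / (1 + β))).real {y | 1 ≤ y} ≤ α * β := by nlinarith
    linarith
  calc _ ≤ ∑ _i : Fin n, (α * β + p * (negBinomial α (1 / (1 + (β + δ)))).real Fᶜ +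
        2 * μ.real {ω | τ₀ < tauHat n (counts ω)}) := Finset.sum_le_sum fun i _ => hi i
    _ = _ := by
        simp only [Finset.sum_const, Finset.card_univ, Fintype.card_fin, nsmul_eq_mul]

end Rules

/-! ### Limits of the parameter sequences and error terms -/
section Asymptotics

variable {p β : ℕ → ℝ}

lemma tendsto_zero_of_asympProportional_rpow {ε : ℝ} (hε : 0 < ε)
    (h : AsympProportional p (fun n => (n : ℝ) ^ (-ε))) : Tendsto p atTop (𝓝 0) := by
  obtain ⟨c, _, hlim⟩ := h
  have h0 : Tendsto (fun n : ℕ => (n : ℝ) ^ (-ε)) atTop (𝓝 0) :=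
    (tendsto_rpow_neg_atTop hε).comp tendsto_natCast_atTop_atTop
  have := hlim.mul h0
  rw [mul_zero] at this
  refine this.congr' ?_
  filter_upwards [eventually_gt_atTop 0] with n hn
  have hn : (0 : ℝ) < n := by exact_mod_cast hn
  exact div_mul_cancel₀ _ (by positivity)

lemma tendsto_div_zero_of_asympProportional_rpow {C : ℝ} (hC : 1 < C)
    (hp : ∀ᶠ n in atTop, 0 < p n) (hp0 : Tendsto p atTop (𝓝 0))
    (h : AsympProportional β (fun n => p n ^ C)) :
    Tendsto (fun n => β n / p n) atTop (𝓝 0) := by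
  obtain ⟨c, _, hlim⟩ := h
  have h0 : Tendsto (fun n => p n ^ (C - 1)) atTop (𝓝 0) := by
    have := hp0.rpow_const (p := C - 1) (Or.inr (by linarith))
    rwa [Real.zero_rpow (by linarith)] at this
  have := hlim.mul h0
  rw [mul_zero] at this
  refine this.congr' ?_
  filter_upwards [hp] with n hn
  rw [Real.rpow_sub_one hn.ne']
  field_simp

/-- The error term coming from large values of the estimate of `τ` is `o(p)`. -/
lemma tendsto_tauHat_error_div {α τ₀ : ℝ} (hp : ∀ᶠ n in atTop, 0 < p n)
    (hp0 : Tendsto p atTop (𝓝 0)) (hβp : Tendsto (fun n => β n / p n) atTop (𝓝 0)) :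
    Tendsto (fun n : ℕ => ((α * β n + p n) / n + (α * β n + p n) ^ 2) / τ₀ ^ 2 / p n)
      atTop (𝓝 0) := by
  have h1 : Tendsto (fun n => α * (β n / p n) + 1) atTop (𝓝 (α * 0 + 1)) :=
    (hβp.const_mul α).add_const 1
  have h2 : Tendsto (fun n : ℕ => ((α * (β n / p n) + 1) * (n : ℝ)⁻¹ +
      (α * (β n / p n) + 1) ^ 2 * p n) / τ₀ ^ 2) atTop (𝓝 0) := by
    have := ((h1.mul tendsto_inv_atTop_nhds_zero_nat).add ((h1.pow 2).mul hp0)).div_const (τ₀ ^ 2)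
    simpa using this
  refine h2.congr' ?_
  filter_upwards [hp] with n hn
  field_simp

/-- The probability of avoiding the rejected counts up to `N` tends to that of `Y ≤ T`. -/
lemma tendsto_negBinomial_real_filter_compl {α s : ℝ} (hα : 0 < α) (hs : 0 < s) (T : ℝ) :
    Tendsto (fun N : ℕ => (negBinomial α (1 / (1 + s))).real
        (((Finset.range (N + 1)).filter fun y : ℕ => T < y : Finset ℕ) : Set ℕ)ᶜ) atTop
      (𝓝 ((negBinomial α (1 / (1 + s))).real {y : ℕ | (y : ℝ) ≤ T})) := by
  have := isProbabilityMeasure_negBinomial hα hs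
  set ν := negBinomial α (1 / (1 + s))
  have hmono : Monotone fun N : ℕ =>
      (((Finset.range (N + 1)).filter fun y : ℕ => T < y : Finset ℕ) : Set ℕ) := by
    intro N N' hN y hy
    simp only [Finset.coe_filter, Finset.mem_range, mem_ofPred_eq] at hy ⊢
    exact ⟨by omega, hy.2⟩
  have hU : (⋃ N : ℕ, (((Finset.range (N + 1)).filter fun y : ℕ => T < y : Finset ℕ) : Set ℕ)) =
      {y : ℕ | (y : ℝ) ≤ T}ᶜ := by
    ext y
    simp only [mem_iUnion, Finset.coe_filter, Finset.mem_range, mem_ofPred_eq, mem_compl_iff,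
      not_le]
    exact ⟨fun ⟨_, h⟩ => h.2, fun h => ⟨y, by omega, h⟩⟩
  have h1 := tendsto_measure_iUnion_atTop (μ := ν) hmono
  rw [hU] at h1
  have h2 := (ENNReal.tendsto_toReal (measure_ne_top ν _)).comp h1
  have h3 := h2.const_sub 1
  have e : 1 - (ν {y : ℕ | (y : ℝ) ≤ T}ᶜ).toReal = ν.real {y : ℕ | (y : ℝ) ≤ T} := by
    rw [← measureReal_def, probReal_compl_eq_one_sub (.of_discrete)]
    ring
  rw [e] at h3
  refine h3.congr fun N => ?_
  rw [probReal_compl_eq_one_sub (.of_discrete)]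
  rfl

end Asymptotics

/-! ### Asymptotics of the risk ratio -/

section Ratio

variable {α δ : ℝ} {p β : ℕ → ℝ} {K a τ₀ : ℝ} {L : ℝ → ℝ}

lemma eventually_bayesRisk_oracleRule (hα : 0 < α) (hδ : 0 < δ)
    (hp : ∀ n, 1 ≤ n → 0 < p n ∧ p n < 1) (hβ : ∀ n, 1 ≤ n → 0 < β n)
    (hp0 : Tendsto p atTop (𝓝 0)) (hβp : Tendsto (fun n => β n / p n) atTop (𝓝 0)) :
    ∀ᶠ n in atTop, bayesRisk n (p n) α (β n) δ (oracleRule n (p n) α (β n) δ) =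
      n * ((1 - p n) * (negBinomial α (1 / (1 + β n))).real {y | 1 ≤ y} +
        p n * (negBinomial α (1 / (1 + (β n + δ)))).real {0}) := by
  have hc : 0 < δ / ((1 + δ) ^ α * (1 + δ)) := by positivity
  filter_upwards [eventually_ge_atTop 1, hp0.eventually_le_const (show (0 : ℝ) < 1 / 2 by norm_num),
    hβp.eventually_lt_const hc] with n hn hn2 hn3
  refine bayesRisk_oracleRule (hp n hn).1 hn2 hα (hβ n hn) hδ ?_
  rw [div_lt_div_iff₀ (hp n hn).1 (by positivity)] at hn3
  exact hn3

lemma tendsto_group_scale {β : ℕ → ℝ} (hβ0 : Tendsto β atTop (𝓝 0)) :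
    Tendsto (fun n => β n + δ) atTop (𝓝 δ) := by
  simpa using hβ0.add_const δ

lemma tendsto_oracle_typeII (hα : 0 < α) (hδ : 0 < δ) (hβ0 : Tendsto β atTop (𝓝 0)) :
    Tendsto (fun n => (negBinomial α (1 / (1 + (β n + δ)))).real {0}) atTop
      (𝓝 ((1 + δ) ^ (-α))) := by
  have h := tendsto_negBinomial_real_finset hα hδ {0} (tendsto_group_scale (δ := δ) hβ0)
  rwa [Finset.coe_singleton, negBinomial_real_zero hα hδ] at h

/-- The empirical Bayes risk is asymptotically at least the oracle risk: both rules accept zero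
counts, and this error dominates the oracle risk. -/
lemma one_le_liminf_ratio (hα : 0 < α) (hδ : 0 < δ)
    (hp : ∀ n, 1 ≤ n → 0 < p n ∧ p n < 1) (hβ : ∀ n, 1 ≤ n → 0 < β n)
    (hp0 : Tendsto p atTop (𝓝 0)) (hβp : Tendsto (fun n => β n / p n) atTop (𝓝 0))
    (hβ0 : Tendsto β atTop (𝓝 0)) (hτ₀ : 0 < τ₀)
    (hdec : ∀ τ, 0 < τ → τ ≤ τ₀ → 1 - posteriorMean K a L α τ 0 ≤ δ / (2 * (δ + 1))) :
    1 ≤ liminf (fun n => ((bayesRisk n (p n) α (β n) δ (ebRule n K a L α δ) /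
        bayesRisk n (p n) α (β n) δ (oracleRule n (p n) α (β n) δ) : ℝ) : EReal)) atTop := by
  set z : ℕ → ℝ := fun n => (negBinomial α (1 / (1 + (β n + δ)))).real {0}
  set e : ℕ → ℝ := fun n => ((α * β n + p n) / n + (α * β n + p n) ^ 2) / τ₀ ^ 2 with he
  have hpe : ∀ᶠ n in atTop, 0 < p n := (eventually_ge_atTop 1).mono fun n hn => (hp n hn).1
  have hzlim : Tendsto z atTop (𝓝 ((1 + δ) ^ (-α))) := tendsto_oracle_typeII hα hδ hβ0
  have helim : Tendsto (fun n => e n / p n) atTop (𝓝 0) := tendsto_tauHat_error_div hpe hp0 hβp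
  have hz0 : 0 < (1 + δ) ^ (-α) := by positivity
  have hlim : Tendsto (fun n => (z n - e n / p n) / (α * (β n / p n) + z n)) atTop (𝓝 1) := by
    have := (hzlim.sub helim).div ((hβp.const_mul α).add hzlim) (by simpa using hz0.ne')
    rw [sub_zero, mul_zero, zero_add, div_self hz0.ne'] at this
    exact this
  have hle : ∀ᶠ n in atTop, (z n - e n / p n) / (α * (β n / p n) + z n) ≤
      bayesRisk n (p n) α (β n) δ (ebRule n K a L α δ) /
        bayesRisk n (p n) α (β n) δ (oracleRule n (p n) α (β n) δ) := by
    filter_upwards [eventually_ge_atTop 1, eventually_bayesRisk_oracleRule hα hδ hp hβ hp0 hβp,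
      tendsto_one_div_atTop_nhds_zero_nat.eventually_le_const hτ₀,
      (hzlim.sub helim).eventually_const_lt (by simpa using hz0),
      hzlim.eventually_const_lt hz0] with n hn hor hnτ hze hzn
    have hpn := (hp n hn).1
    have hβn := hβ n hn
    have hn0 : (0 : ℝ) < n := by exact_mod_cast hn
    have h1 := le_bayesRisk_ebRule (K := K) (a := a) (L := L) hpn (hp n hn).2 hα hβn hδ hn hdec
    have h2 := twoGroupModel_real_tauHat_gt_le hpn (hp n hn).2 hα hβn hδ hn hτ₀ hnτ
    have h3 := negBinomial_real_pos_le hα hβn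
    have h4 : 0 ≤ (negBinomial α (1 / (1 + β n))).real {y | 1 ≤ y} := measureReal_nonneg
    have h5 : (1 - p n) * (negBinomial α (1 / (1 + β n))).real {y | 1 ≤ y} ≤ α * β n := by
      nlinarith
    have h6 : 0 ≤ (1 - p n) * (negBinomial α (1 / (1 + β n))).real {y | 1 ≤ y} :=
      mul_nonneg (by linarith [(hp n hn).2]) h4
    have hzp : 0 < p n * z n := mul_pos hpn hzn
    have e1 : (z n - e n / p n) / (α * (β n / p n) + z n) =
        (n * (p n * z n - e n)) / (n * (α * β n + p n * z n)) := by
      rw [mul_div_mul_left _ _ hn0.ne']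
      field_simp
    have hnum : 0 ≤ p n * z n - e n := by
      have := mul_pos hpn hze
      rw [mul_sub, mul_div_cancel₀ _ hpn.ne'] at this
      exact this.le
    rw [e1, hor]
    refine div_le_div₀ ?_ ?_ (mul_pos hn0 (by linarith)) ?_
    · exact (by positivity : 0 ≤ n * (p n * z n - e n)).trans
        ((mul_le_mul_of_nonneg_left (by linarith) hn0.le).trans h1)
    · exact (mul_le_mul_of_nonneg_left (by linarith) hn0.le).trans h1
    · exact mul_le_mul_of_nonneg_left (by linarith) hn0.le
  have hE := ((continuous_coe_real_ereal.tendsto _).comp hlim).liminf_eq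
  rw [← EReal.coe_one, ← hE]
  exact liminf_le_liminf (hle.mono fun n hn => EReal.coe_le_coe_iff.2 hn)

/-- An upper bound for the risk ratio when the rule rejects, for small `τ`, at every count in `F`. -/
lemma limsup_ratio_le (hα : 0 < α) (hδ : 0 < δ)
    (hp : ∀ n, 1 ≤ n → 0 < p n ∧ p n < 1) (hβ : ∀ n, 1 ≤ n → 0 < β n)
    (hp0 : Tendsto p atTop (𝓝 0)) (hβp : Tendsto (fun n => β n / p n) atTop (𝓝 0))
    (hβ0 : Tendsto β atTop (𝓝 0)) (hτ₀ : 0 < τ₀) (F : Finset ℕ)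
    (hdec : ∀ τ, 0 < τ → τ ≤ τ₀ → 1 - posteriorMean K a L α τ 0 ≤ δ / (2 * (δ + 1)))
    (hF : ∀ τ, 0 < τ → τ ≤ τ₀ → ∀ y ∈ F, δ / (2 * (δ + 1)) < 1 - posteriorMean K a L α τ y) :
    limsup (fun n => ((bayesRisk n (p n) α (β n) δ (ebRule n K a L α δ) /
        bayesRisk n (p n) α (β n) δ (oracleRule n (p n) α (β n) δ) : ℝ) : EReal)) atTop ≤
      (((1 + δ) ^ α * (negBinomial α (1 / (1 + δ))).real (F : Set ℕ)ᶜ : ℝ) : EReal) := by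
  set z : ℕ → ℝ := fun n => (negBinomial α (1 / (1 + (β n + δ)))).real {0}
  set w : ℕ → ℝ := fun n => (negBinomial α (1 / (1 + (β n + δ)))).real (F : Set ℕ)ᶜ
  set e : ℕ → ℝ := fun n => ((α * β n + p n) / n + (α * β n + p n) ^ 2) / τ₀ ^ 2 with he
  have hpe : ∀ᶠ n in atTop, 0 < p n := (eventually_ge_atTop 1).mono fun n hn => (hp n hn).1
  have hzlim : Tendsto z atTop (𝓝 ((1 + δ) ^ (-α))) := tendsto_oracle_typeII hα hδ hβ0
  have hwlim := tendsto_negBinomial_real_compl hα hδ F (tendsto_group_scale (δ := δ) hβ0)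
  have helim : Tendsto (fun n => e n / p n) atTop (𝓝 0) := tendsto_tauHat_error_div hpe hp0 hβp
  have hz0 : 0 < (1 + δ) ^ (-α) := by positivity
  have hlim : Tendsto (fun n => (α * (β n / p n) + w n + 2 * (e n / p n)) / z n) atTop
      (𝓝 ((1 + δ) ^ α * (negBinomial α (1 / (1 + δ))).real (F : Set ℕ)ᶜ)) := by
    have := (((hβp.const_mul α).add hwlim).add (helim.const_mul 2)).div hzlim hz0.ne'
    have e1 : (α * 0 + (negBinomial α (1 / (1 + δ))).real (F : Set ℕ)ᶜ + 2 * 0) /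
        (1 + δ) ^ (-α) = (1 + δ) ^ α * (negBinomial α (1 / (1 + δ))).real (F : Set ℕ)ᶜ := by
      rw [Real.rpow_neg (by positivity), div_inv_eq_mul]
      ring
    rwa [e1] at this
  have hle : ∀ᶠ n in atTop, bayesRisk n (p n) α (β n) δ (ebRule n K a L α δ) /
        bayesRisk n (p n) α (β n) δ (oracleRule n (p n) α (β n) δ) ≤
      (α * (β n / p n) + w n + 2 * (e n / p n)) / z n := by
    filter_upwards [eventually_ge_atTop 1, eventually_bayesRisk_oracleRule hα hδ hp hβ hp0 hβp,
      tendsto_one_div_atTop_nhds_zero_nat.eventually_le_const hτ₀,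
      hzlim.eventually_const_lt hz0] with n hn hor hnτ hzn
    have hpn := (hp n hn).1
    have hβn := hβ n hn
    have hn0 : (0 : ℝ) < n := by exact_mod_cast hn
    have h1 := bayesRisk_ebRule_le hpn (hp n hn).2 hα hβn hδ hn (F : Set ℕ) hdec
      fun τ h h' y hy => hF τ h h' y (Finset.mem_coe.1 hy)
    have h2 := twoGroupModel_real_tauHat_gt_le hpn (hp n hn).2 hα hβn hδ hn hτ₀ hnτ
    have h4 : 0 ≤ (negBinomial α (1 / (1 + β n))).real {y | 1 ≤ y} := measureReal_nonneg
    have h6 : 0 ≤ (1 - p n) * (negBinomial α (1 / (1 + β n))).real {y | 1 ≤ y} :=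
      mul_nonneg (by linarith [(hp n hn).2]) h4
    have hzp : 0 < p n * z n := mul_pos hpn hzn
    have hw0 : 0 ≤ w n := measureReal_nonneg
    have he0 : 0 ≤ e n := by simp only [he]; positivity
    have e1 : (α * (β n / p n) + w n + 2 * (e n / p n)) / z n =
        (n * (α * β n + p n * w n + 2 * e n)) / (n * (p n * z n)) := by
      rw [mul_div_mul_left _ _ hn0.ne']
      field_simp
    rw [e1, hor]
    refine div_le_div₀ (by positivity) ?_ (by positivity) ?_
    · exact h1.trans (mul_le_mul_of_nonneg_left (by linarith) hn0.le)
    · exact mul_le_mul_of_nonneg_left (by linarith) hn0.le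
  have hE := ((continuous_coe_real_ereal.tendsto _).comp hlim).limsup_eq
  rw [← hE]
  exact limsup_le_limsup (hle.mono fun n hn => EReal.coe_le_coe_iff.2 hn)

end Ratio

end SparseCount

theorem mainTheorem2
    (α δ a K : ℝ) (hα : 0 < α) (hδ : 0 < δ) (ha : 1 < a) (hK : 0 < K)
    (L : ℝ → ℝ) (hLmeas : Measurable L) (hLpos : ∀ x, 0 < x → 0 < L x)
    (hLsv : SparseCount.SlowlyVarying L)
    (hdens : ∫⁻ x in Ioi (0 : ℝ), ENNReal.ofReal (SparseCount.localDensity K a L x) = 1)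
    (hA1 : ∃ c₀ : ℝ, 0 < c₀ ∧ ∃ t₀ : ℝ, 0 < t₀ ∧ ∀ t, t₀ ≤ t → c₀ ≤ L t)
    (hA1' : ∃ l : ℝ, 0 < l ∧ Tendsto L atTop (𝓝 l))
    (hA2 : ∃ M : ℝ, 0 < M ∧ ∀ t, 0 < t → L t ≤ M)
    (p β : ℕ → ℝ)
    (hp : ∀ n, 1 ≤ n → 0 < p n ∧ p n < 1) (hβ : ∀ n, 1 ≤ n → 0 < β n)
    (ε : ℝ) (hε0 : 0 < ε) (hε1 : ε < 1)
    (hpε : SparseCount.AsympProportional p (fun n => (n : ℝ) ^ (-ε)))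
    (C₁ : ℝ) (hC₁ : 1 < C₁)
    (hβp : SparseCount.AsympProportional β (fun n => p n ^ C₁)) :
    let ratio : ℕ → EReal := fun n =>
      ((SparseCount.bayesRisk n (p n) α (β n) δ (SparseCount.ebRule n K a L α δ) /
        SparseCount.bayesRisk n (p n) α (β n) δ (SparseCount.oracleRule n (p n) α (β n) δ) : ℝ) :
        EReal)
    1 ≤ liminf ratio atTop ∧
    liminf ratio atTop ≤ limsup ratio atTop ∧
    limsup ratio atTop ≤
      (((δ + 1) ^ α * (SparseCount.negBinomial α (1 / (δ + 1))).real
        {y : ℕ | (y : ℝ) ≤ 2 * a + α - 2 * (a + α) / (δ + 2)} : ℝ) : EReal) := by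
  obtain ⟨l, hl0, hl⟩ := hA1'
  obtain ⟨M, _, hM⟩ := hA2
  have ha0 : 0 < a := one_pos.trans ha
  have hp0 := SparseCount.tendsto_zero_of_asympProportional_rpow hε0 hpε
  have hpe : ∀ᶠ n in atTop, 0 < p n := (eventually_ge_atTop 1).mono fun n hn => (hp n hn).1
  have hβp' := SparseCount.tendsto_div_zero_of_asympProportional_rpow hC₁ hpe hp0 hβp
  have hβ0 : Tendsto β atTop (𝓝 0) := by
    have := hβp'.mul hp0
    rw [mul_zero] at this
    exact this.congr' (hpe.mono fun n hn => div_mul_cancel₀ _ hn.ne')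
  have hdec := SparseCount.exists_decision_threshold hδ hLmeas hK hLpos hdens hl0 hl hM ha0 hα
  refine ⟨?_, liminf_le_limsup, ?_⟩
  -- only the decision at the count `0` matters for the lower bound
  · obtain ⟨τ₀, hτ₀, h⟩ := hdec 0
    exact SparseCount.one_le_liminf_ratio hα hδ hp hβ hp0 hβp' hβ0 hτ₀
      fun τ h0 h1 => (h τ h0 h1).1
  · rw [add_comm δ 1]
    have hlim := (SparseCount.tendsto_negBinomial_real_filter_compl hα hδ
      (2 * a + α - 2 * (a + α) / (δ + 2))).const_mul ((1 + δ) ^ α)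
    -- the bound holds for each `N`, with a level `τ₀` depending on `N`; then `N → ∞`
    refine ge_of_tendsto ((continuous_coe_real_ereal.tendsto _).comp hlim)
      (Eventually.of_forall fun N => ?_)
    obtain ⟨τ₀, hτ₀, h⟩ := hdec N
    refine SparseCount.limsup_ratio_le hα hδ hp hβ hp0 hβp' hβ0 hτ₀ _
      (fun τ h0 h1 => (h τ h0 h1).1) fun τ h0 h1 y hy => ?_
    rw [Finset.mem_filter, Finset.mem_range] at hy
    exact (h τ h0 h1).2 y (by omega) hy.2
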